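/- For $\alpha,\beta>-1$ let $\mathrm{P}_m^{(\alpha,\beta)}$ be the $m$th Jacobi polynomial and $g_m^{(\alpha,\beta)}=\int_{-1}^1(1-t)^\alpha(1+t)^\beta[\mathrm{P}_m^{(\alpha,\beta)}(t)]^2\,\mathrm{d}t$. For $\alpha>-1$ and $m\in\mathbb{Z}_+$ set $$\varphi^{\alpha}_{2m}(x)=\frac{2^{(2\alpha+1)/4}}{\sqrt{g_m^{(\alpha,-1/2)}}}\,\frac{1}{\cosh^{1+\alpha}x}\,\mathrm{P}_m^{(\alpha,-1/2)}\!\left(1-\frac{2}{\cosh^2x}\right),\qquad \varphi^{\alpha}_{2m+1}(x)=-\frac{2^{(2\alpha+3)/4}}{\sqrt{g_m^{(\alpha,1/2)}}}\,\frac{\sinh x}{\cosh^{2+\alpha}x}\,\mathrm{P}_m^{(\alpha,1/2)}\!\left(1-\frac{2}{\cosh^2x}\right).$$ A system $\{\varphi_m\}_{m\in\mathbb{Z}_+}$ of real functions on $\mathbb{R}$ is called a half-range system if $\varphi_{2m}(x)=\Theta_{\mathrm{E}}(x)\,r_m(H(x))$ and $\varphi_{2m+1}(x)=\Theta_{\mathrm{O}}(x)\,s_m(H(x))$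 for all $m\in\mathbb{Z}_+$ and $x\in\mathbb{R}$, where $\Theta_{\mathrm{E}}$ is an even function with $\Theta_{\mathrm{E}}(0)\ne0$; $\Theta_{\mathrm{O}}$ is an odd function; $\{r_m\}$ and $\{s_m\}$ (with $\deg r_m=\deg s_m=m$) are orthonormal polynomial systems with respect to measures $w_{\mathrm{E}}(t)\,\mathrm{d}t$ and $w_{\mathrm{O}}(t)\,\mathrm{d}t$ on $(-1,1)$, with nonnegative integrable weights $w_{\mathrm{E}},w_{\mathrm{O}}$; and $H$ is an even function whose restriction to $(0,\infty)$ is the inverse of a differentiable map $h$ of $(-1,1)$ onto $(0,\infty)$ with $h'>0$. A differentiation matrix of differentiable functions $\{\varphi_m\}$ is a real infinite matrix $\mathcal{D}$ with $\varphi_m'=\sum_{k}\mathcal{D}_{m,k}\varphi_k$ for all $m$. **Theorem.** (a) A system $\{\varphi_m\}$ is a half-range system which is orthonormal in $L_2(\mathbb{R})$ and possesses a tridiagonal, skew-symmetric differentiation matrix if and only if it is, up to a linear change of variables and signs, one of the systems $\{\varphi_m^\alpha\}$, i.e. if and only if there are $\alpha>-1$, $c>0$ and $\varepsilon_m\in\{1,-1\}$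 such that $\varphi_m(x)=\varepsilon_m\sqrt{c}\,\varphi_m^{\alpha}(cx)$ for all $m\in\mathbb{Z}_+$ and $x\in\mathbb{R}$. (b) If in addition the superdiagonal entries $b_m=\mathcal{D}_{m,m+1}$ are required to be positive for all $m$, then the equivalence holds with $\varepsilon_m=\varepsilon\in\{1,-1\}$ independent of $m$. (c) For every $\alpha>-1$, $m\in\mathbb{Z}_+$ and $x\in\mathbb{R}$, $$\varphi_m^{\alpha}(x)=\frac{(-1)^m}{\sqrt{g_m^{(\alpha,\alpha)}}}(1-\tanh x)^{(\alpha+1)/2}(1+\tanh x)^{(\alpha+1)/2}\,\mathrm{P}_m^{(\alpha,\alpha)}(\tanh x).$$ -/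

import Mathlib

open MeasureTheory Set

noncomputable section

/-- The Jacobi polynomial `P_n^{(α,β)}`, by its explicit expansion at the point `1`:
`∑_{l ≤ n} (n+α+β+1)_l (α+l+1)_{n-l} / (l! (n-l)!) ((t-1)/2)^l`, with rising factorials `(a)_l`. -/
def jacobiPoly (α β : ℝ) (n : ℕ) : Polynomial ℝ :=
  ∑ l ∈ Finset.range (n + 1),
    Polynomial.C ((ascPochhammer ℝ l).eval (n + α + β + 1)
        * (ascPochhammer ℝ (n - l)).eval (α + l + 1) / (l.factorial * (n - l).factorial))
      * (Polynomial.C (1 / 2) * (Polynomial.X - 1)) ^ l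

/-- The squared norm `g_m^{(α,β)} = ∫_{-1}^1 (1-t)^α (1+t)^β P_m^{(α,β)}(t)² dt`. -/
def jacobiNormSq (α β : ℝ) (m : ℕ) : ℝ :=
  ∫ t in Ioo (-1 : ℝ) 1, (1 - t) ^ α * (1 + t) ^ β * ((jacobiPoly α β m).eval t) ^ 2

/-- The full-range functions (tanh-Jacobi functions) with parameters `α, β`. -/
def tanhJacobi (α β : ℝ) (m : ℕ) (x : ℝ) : ℝ :=
  (-1) ^ m / √(jacobiNormSq α β m) * (1 - Real.tanh x) ^ ((α + 1) / 2)
    * (1 + Real.tanh x) ^ ((β + 1) / 2) * (jacobiPoly α β m).eval (Real.tanh x)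

/-- The even members of the half-range family, of index `2m`. -/
def halfRangeEven (α : ℝ) (m : ℕ) (x : ℝ) : ℝ :=
  (2 : ℝ) ^ ((2 * α + 1) / 4) / √(jacobiNormSq α (-1 / 2) m)
    * (1 / Real.cosh x ^ (1 + α))
    * (jacobiPoly α (-1 / 2) m).eval (1 - 2 / Real.cosh x ^ 2)

/-- The odd members of the half-range family, of index `2m+1`. -/
def halfRangeOdd (α : ℝ) (m : ℕ) (x : ℝ) : ℝ :=
  -((2 : ℝ) ^ ((2 * α + 3) / 4) / √(jacobiNormSq α (1 / 2) m)
    * (Real.sinh x / Real.cosh x ^ (2 + α))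
    * (jacobiPoly α (1 / 2) m).eval (1 - 2 / Real.cosh x ^ 2))

/-- The half-range family with parameter `α`. -/
def halfRangeJacobi (α : ℝ) (m : ℕ) (x : ℝ) : ℝ :=
  if Even m then halfRangeEven α (m / 2) x else halfRangeOdd α (m / 2) x

/-- `p` is a system of orthonormal polynomials with respect to the absolutely continuous measure
`w(t) dt` on `(-1,1)`: `p m` has degree exactly `m`. The signs of the leading coefficients
are not prescribed. -/
structure IsOrthonormalPolySystem (w : ℝ → ℝ) (p : ℕ → Polynomial ℝ) : Prop where
  weight_nonneg : ∀ t ∈ Ioo (-1 : ℝ) 1, 0 ≤ w t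
  weight_integrable : IntegrableOn w (Ioo (-1) 1)
  degree_eq : ∀ m : ℕ, (p m).degree = m
  orthonormal : ∀ m n : ℕ,
    ∫ t in Ioo (-1 : ℝ) 1, (p m).eval t * (p n).eval t * w t = if m = n then 1 else 0

/-- The half-range model: `φ_{2m} = Θ_E · r_m(H)`, `φ_{2m+1} = Θ_O · s_m(H)`. Here `h` is a
differentiable map of `(-1,1)` onto `(0,∞)` with positive derivative, `H` is its inverse, extended
to an even function on the line, `Θ_E` is even and nonzero at the origin, `Θ_O` is odd. -/
structure IsHalfRangeModel (φ : ℕ → ℝ → ℝ) (h H ΘE ΘO wE wO : ℝ → ℝ)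
    (r s : ℕ → Polynomial ℝ) : Prop where
  h_differentiable : ∀ t ∈ Ioo (-1 : ℝ) 1, DifferentiableAt ℝ h t
  h_deriv_pos : ∀ t ∈ Ioo (-1 : ℝ) 1, 0 < deriv h t
  h_onto : h '' Ioo (-1) 1 = Ioi 0
  H_inverse : ∀ t ∈ Ioo (-1 : ℝ) 1, H (h t) = t
  H_even : Function.Even H
  ΘE_even : Function.Even ΘE
  ΘO_odd : Function.Odd ΘO
  ΘE_zero : ΘE 0 ≠ 0
  r_orthonormal : IsOrthonormalPolySystem wE r
  s_orthonormal : IsOrthonormalPolySystem wO s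
  even_eq : ∀ (m : ℕ) (x : ℝ), φ (2 * m) x = ΘE x * (r m).eval (H x)
  odd_eq : ∀ (m : ℕ) (x : ℝ), φ (2 * m + 1) x = ΘO x * (s m).eval (H x)

/-- `φ` can be written in the form of the half-range model. -/
def IsHalfRangeSystem (φ : ℕ → ℝ → ℝ) : Prop :=
  ∃ (h H ΘE ΘO wE wO : ℝ → ℝ) (r s : ℕ → Polynomial ℝ),
    IsHalfRangeModel φ h H ΘE ΘO wE wO r s

/-- `φ` is an orthonormal system of real functions in `L₂(ℝ)`. -/
def IsOrthonormalSystem (φ : ℕ → ℝ → ℝ) : Prop :=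
  (∀ m, MemLp (φ m) 2 volume) ∧
    ∀ m n, ∫ x, φ m x * φ n x = if m = n then 1 else 0

/-- `D` is a differentiation matrix of `φ`: `φ_m' = ∑_k D_{m,k} φ_k`. -/
def IsDifferentiationMatrix (φ : ℕ → ℝ → ℝ) (D : Matrix ℕ ℕ ℝ) : Prop :=
  ∀ m, Differentiable ℝ (φ m) ∧ ∀ x, HasSum (fun k => D m k * φ k x) (deriv (φ m) x)

/-- `D` vanishes off the main diagonal and the two adjacent diagonals. -/
def IsTridiagonal (D : Matrix ℕ ℕ ℝ) : Prop :=
  ∀ m k, (m + 1 < k ∨ k + 1 < m) → D m k = 0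

/-- `D` is skew-symmetric. -/
def IsSkewSymmetric (D : Matrix ℕ ℕ ℝ) : Prop := D.transpose = -D

end

/-!
The half-range functions with parameter `α` are, up to signs, the functions
`cosh^{-(α+1)} x · p_m(tanh x)`, where `p_m` are the orthonormal polynomials for `(1-t²)^α`.

*Coincidence with the tanh-Jacobi functions.* The polynomials `P_k^{(α,-1/2)}(2t²-1)` and
`t P_k^{(α,1/2)}(2t²-1)` are orthogonal for `(1-t²)^α` by parity and the substitution `s = 2t²-1`.
Orthonormal polynomials with positive leading coefficients are unique, so after normalization these
are the ultraspherical polynomials (`quadraticJacobi_eq`). Orthogonality of the Jacobi polynomials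
comes from their differential equation, which is read off from the explicit coefficients.

*The family has the required properties.* The substitution `t = tanh x` gives orthonormality on the
line. The derivative of `cosh^{-(α+1)} p_m(tanh)` is `cosh^{-(α+1)} q_m(tanh)` with `q_m` of degree
`m + 1`; expanding `q_m` in the `p_k` gives the differentiation matrix, integration by parts its
skew-symmetry, and therefore tridiagonality. Comparison of leading coefficients gives the sign of
the superdiagonal (`halfRangeMatrix_superdiagonal_pos`).

*There are no other systems.* The formulas for `φ_0', …, φ_3'` express `Θ_E' / Θ_O` as a constant,
`Θ_O' / Θ_E` and `Θ_E H' / Θ_O` as polynomials of degree at most one in `H`, and `Θ_O H' / Θ_E` as a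
quadratic `Q(H)`. Hence `H'² = A(H) Q(H)` with `A` of degree at most one. Since `Θ_O(0) = 0` and
`H(0) = -1`, the quadratic vanishes at `-1`; since `H` increases to `1` without reaching it, the cubic
`A Q` has a double zero at `1` (`double_root_of_profile`). This leaves `H'² = κ (1-H)² (1+H)`, whose
solution is `H = 2 tanh²(cx) - 1`, and then `Θ_E` is a power of `cosh(cx)` and `Θ_O` a multiple of
`tanh(cx) Θ_E` (`IsHalfRangeModel.exists_tanh_form`). Square integrability makes the power negative,
and uniqueness of orthonormal polynomials fixes everything up to signs.

*Signs.* The entries of the differentiation matrix are integrals `∫ φ_m' φ_k`, so a change of signs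
`ε` multiplies the superdiagonal by `ε_m ε_{m+1}`; positivity forces `ε` to be constant.
-/

open Polynomial Filter Topology

/-! ### Orthonormal polynomials for a linear functional -/

theorem Polynomial.exists_eq_sum_of_degree_eq {p : ℕ → ℝ[X]} (hp : ∀ m : ℕ, (p m).degree = m)
    (N : ℕ) : ∀ f : ℝ[X], f.degree < N → ∃ a : ℕ → ℝ, f = ∑ k ∈ Finset.range N, C (a k) * p k := by
  induction N with
  | zero =>
    intro f hf
    refine ⟨0, ?_⟩
    simpa using hf
  | succ N ih =>
    intro f hf
    have hN : (p N).coeff N ≠ 0 := coeff_ne_zero_of_eq_degree (hp N)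
    set b : ℝ := f.coeff N / (p N).coeff N with hb
    obtain ⟨a, ha⟩ := ih (f - C b * p N) (by
      rw [degree_lt_iff_coeff_zero] at hf ⊢
      intro m hm
      rcases hm.eq_or_lt with rfl | hm
      · simp [hb, hN]
      · have h1 : (p N).coeff m = 0 := coeff_eq_zero_of_degree_lt (by rw [hp]; exact_mod_cast hm)
        simp [h1, hf m hm])
    refine ⟨fun k => if k < N then a k else b, ?_⟩
    rw [Finset.sum_range_succ, ← sub_eq_iff_eq_add]
    simp only [lt_irrefl, if_false]
    rw [ha]
    exact Finset.sum_congr rfl fun k hk => by simp [Finset.mem_range.mp hk]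

/-- Fourier expansion of a polynomial with respect to polynomials which are orthonormal for the
linear functional `L`. -/
theorem Polynomial.eq_sum_of_orthonormal {L : ℝ[X] →ₗ[ℝ] ℝ} {p : ℕ → ℝ[X]}
    (hp : ∀ m : ℕ, (p m).degree = m) (ho : ∀ m n, L (p m * p n) = if m = n then 1 else 0)
    {N : ℕ} {f : ℝ[X]} (hf : f.degree < N) :
    f = ∑ k ∈ Finset.range N, C (L (f * p k)) * p k := by
  obtain ⟨a, ha⟩ := exists_eq_sum_of_degree_eq hp N f hf
  have key : ∀ k ∈ Finset.range N, L (f * p k) = a k := by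
    intro k hk
    rw [ha, Finset.sum_mul, map_sum]
    have : ∀ j, L (C (a j) * p j * p k) = a j * if j = k then 1 else 0 := by
      intro j
      rw [mul_assoc, C_mul', map_smul, ho, smul_eq_mul]
    simp only [this]
    simp [Finset.mem_range.mp hk]
  calc f = _ := ha
    _ = _ := Finset.sum_congr rfl fun k hk => by rw [key k hk]

theorem Polynomial.functional_mul_eq_zero_of_degree_lt {L : ℝ[X] →ₗ[ℝ] ℝ} {p : ℕ → ℝ[X]}
    (hp : ∀ m : ℕ, (p m).degree = m) (ho : ∀ m n, L (p m * p n) = if m = n then 1 else 0)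
    {N : ℕ} {f : ℝ[X]} (hf : f.degree < N) : L (f * p N) = 0 := by
  rw [eq_sum_of_orthonormal hp ho hf, Finset.sum_mul, map_sum]
  refine Finset.sum_eq_zero fun j hj => ?_
  rw [mul_assoc, C_mul', map_smul, ho, if_neg (Finset.mem_range.mp hj).ne, smul_zero]

/-- Orthonormal polynomials for a linear functional are unique up to signs. -/
theorem Polynomial.eq_or_eq_neg_of_orthonormal {L : ℝ[X] →ₗ[ℝ] ℝ} {p q : ℕ → ℝ[X]}
    (hp : ∀ m : ℕ, (p m).degree = m) (hq : ∀ m : ℕ, (q m).degree = m)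
    (hop : ∀ m n, L (p m * p n) = if m = n then 1 else 0)
    (hoq : ∀ m n, L (q m * q n) = if m = n then 1 else 0) (m : ℕ) :
    q m = p m ∨ q m = -p m := by
  have h1 : q m = C (L (q m * p m)) * p m := by
    conv_lhs => rw [eq_sum_of_orthonormal hp hop (f := q m) (N := m + 1)
      (by rw [hq]; exact_mod_cast Nat.lt_succ_self m), Finset.sum_range_succ]
    rw [Finset.sum_eq_zero, zero_add]
    intro k hk
    rw [mul_comm (q m), functional_mul_eq_zero_of_degree_lt hq hoq
      (by rw [hp]; exact_mod_cast Finset.mem_range.mp hk), C_0, zero_mul]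
  set a := L (q m * p m) with ha
  have h2 : a * a = 1 := by
    have := hoq m m
    rw [h1, if_pos rfl, show C a * p m * (C a * p m) = C (a * a) * (p m * p m) by
      rw [C_mul]; ring, C_mul', map_smul, hop, if_pos rfl] at this
    simpa using this
  rcases mul_self_eq_one_iff.mp h2 with h | h
  · left; rw [h1, h]; simp
  · right; rw [h1, h]; simp

theorem Polynomial.eq_of_orthonormal_of_leadingCoeff_mul_pos {L : ℝ[X] →ₗ[ℝ] ℝ} {p q : ℕ → ℝ[X]}
    (hp : ∀ m : ℕ, (p m).degree = m) (hq : ∀ m : ℕ, (q m).degree = m)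
    (hop : ∀ m n, L (p m * p n) = if m = n then 1 else 0)
    (hoq : ∀ m n, L (q m * q n) = if m = n then 1 else 0) {m : ℕ}
    (hpos : 0 < (p m).leadingCoeff * (q m).leadingCoeff) : q m = p m := by
  rcases eq_or_eq_neg_of_orthonormal hp hq hop hoq m with h | h
  · exact h
  · rw [h, leadingCoeff_neg] at hpos
    nlinarith [mul_self_nonneg (p m).leadingCoeff]

/-- The linear functional `p ↦ ∫ p(H) w dμ` on polynomials. -/
noncomputable def Polynomial.weightedIntegral {X : Type*} [MeasurableSpace X] (μ : Measure X)
    (H w : X → ℝ) (hint : ∀ p : ℝ[X], Integrable (fun x => p.eval (H x) * w x) μ) :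
    ℝ[X] →ₗ[ℝ] ℝ where
  toFun p := ∫ x, p.eval (H x) * w x ∂μ
  map_add' p q := by
    simp only [eval_add, add_mul]
    exact integral_add (hint p) (hint q)
  map_smul' a p := by
    simp only [eval_smul, smul_eq_mul, mul_assoc, RingHom.id_apply]
    exact integral_const_mul _ _

theorem Polynomial.weightedIntegral_apply {X : Type*} [MeasurableSpace X] {μ : Measure X}
    {H w : X → ℝ} (hint : ∀ p : ℝ[X], Integrable (fun x => p.eval (H x) * w x) μ) (p : ℝ[X]) :
    weightedIntegral μ H w hint p = ∫ x, p.eval (H x) * w x ∂μ := rfl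

/-- Polynomials are bounded on `[-1,1]`, so integrability of the weight suffices. -/
theorem Polynomial.integrable_eval_mul {X : Type*} [MeasurableSpace X] {μ : Measure X}
    {H w : X → ℝ} (hH : AEStronglyMeasurable H μ) (hb : ∀ᵐ x ∂μ, H x ∈ Icc (-1 : ℝ) 1)
    (hw : Integrable w μ) (p : ℝ[X]) : Integrable (fun x => p.eval (H x) * w x) μ := by
  obtain ⟨M, hM⟩ := isCompact_Icc.exists_bound_of_continuousOn (s := Icc (-1 : ℝ) 1)
    p.continuous.continuousOn
  refine hw.bdd_mul (c := M) (p.continuous.comp_aestronglyMeasurable hH) ?_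
  filter_upwards [hb] with x hx using hM _ hx

/-! ### Jacobi polynomials -/

/-- The coefficient of `((t-1)/2)^l` in `P_n^{(α,β)}(t)`, for `l ≤ n`. -/
noncomputable def jacobiCoeff (α β : ℝ) (n l : ℕ) : ℝ :=
  (ascPochhammer ℝ l).eval (n + α + β + 1)
    * (ascPochhammer ℝ (n - l)).eval (α + l + 1) / (l.factorial * (n - l).factorial)

/-- The polynomial `Q` with `P_n^{(α,β)}(t) = Q((t-1)/2)`. -/
noncomputable def jacobiPolyShifted (α β : ℝ) (n : ℕ) : ℝ[X] :=
  ∑ l ∈ Finset.range (n + 1), C (jacobiCoeff α β n l) * X ^ l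

theorem jacobiPoly_eq_comp (α β : ℝ) (n : ℕ) :
    jacobiPoly α β n = (jacobiPolyShifted α β n).comp (C (1 / 2) * (X - 1)) := by
  rw [jacobiPolyShifted, ← coe_compRingHom_apply, map_sum, jacobiPoly]
  refine Finset.sum_congr rfl fun l _ => ?_
  rw [coe_compRingHom_apply, mul_comp, C_comp, X_pow_comp, jacobiCoeff]

theorem coeff_jacobiPolyShifted (α β : ℝ) (n l : ℕ) :
    (jacobiPolyShifted α β n).coeff l = if l < n + 1 then jacobiCoeff α β n l else 0 := by
  simp [jacobiPolyShifted, coeff_X_pow]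

/-- The two-term recurrence of the coefficients, which is the Jacobi differential equation read
off at the point `t = 1`. -/
theorem jacobiCoeff_succ (α β : ℝ) {n l : ℕ} (hl : l < n) :
    (l + 1) * (l + 1 + α) * jacobiCoeff α β n (l + 1)
      = (n - l) * (n + l + α + β + 1) * jacobiCoeff α β n l := by
  obtain ⟨k, rfl⟩ := Nat.exists_eq_add_of_lt hl
  have e1 : l + k + 1 - l = k + 1 := by omega
  have e2 : l + k + 1 - (l + 1) = k := by omega
  have h1 : (ascPochhammer ℝ (k + 1)).eval (α + l + 1)
      = (α + l + 1) * (ascPochhammer ℝ k).eval (α + l + 1 + 1) := by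
    rw [ascPochhammer_succ_left]; simp
  have h2 : ∀ x : ℝ, (ascPochhammer ℝ (l + 1)).eval x
      = (ascPochhammer ℝ l).eval x * (x + l) := by
    intro x; rw [ascPochhammer_succ_right]; simp
  have hl0 : (l.factorial : ℝ) ≠ 0 := by positivity
  have hk0 : (k.factorial : ℝ) ≠ 0 := by positivity
  have hl1 : (l + 1 : ℝ) ≠ 0 := by positivity
  have hk1 : (k + 1 : ℝ) ≠ 0 := by positivity
  simp only [jacobiCoeff, e1, e2, h1, h2, Nat.factorial_succ]
  push_cast
  rw [show α + (l + 1 : ℝ) + 1 = α + l + 1 + 1 by ring]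
  field_simp
  ring

theorem jacobiCoeff_self_pos {α β : ℝ} (hα : -1 < α) (hβ : -1 < β) (n : ℕ) :
    0 < jacobiCoeff α β n n := by
  rcases Nat.eq_zero_or_pos n with rfl | hn
  · simp [jacobiCoeff]
  · have hn' : (1 : ℝ) ≤ n := by exact_mod_cast hn
    have := ascPochhammer_pos n ((n : ℝ) + α + β + 1) (by linarith)
    simp only [jacobiCoeff, Nat.sub_self, ascPochhammer_zero, eval_one, Nat.factorial_zero]
    positivity

theorem natDegree_jacobiPolyShifted {α β : ℝ} (hα : -1 < α) (hβ : -1 < β) (n : ℕ) :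
    (jacobiPolyShifted α β n).natDegree = n := by
  refine le_antisymm (natDegree_le_iff_coeff_eq_zero.mpr fun m hm => ?_)
    (le_natDegree_of_ne_zero ?_)
  · rw [coeff_jacobiPolyShifted, if_neg (by omega)]
  · rw [coeff_jacobiPolyShifted, if_pos (by omega)]
    exact (jacobiCoeff_self_pos hα hβ n).ne'

theorem leadingCoeff_jacobiPoly_pos {α β : ℝ} (hα : -1 < α) (hβ : -1 < β) (n : ℕ) :
    0 < (jacobiPoly α β n).leadingCoeff := by
  have e : (C (1 / 2) * (X - 1) : ℝ[X]) = C (1 / 2) * (X - C 1) := by simp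
  have hd : (C (1 / 2) * (X - 1) : ℝ[X]).natDegree = 1 := by
    rw [e, natDegree_C_mul (by norm_num), natDegree_X_sub_C]
  rw [jacobiPoly_eq_comp, leadingCoeff_comp (by rw [hd]; norm_num), e, leadingCoeff_mul,
    leadingCoeff_C, leadingCoeff_X_sub_C, leadingCoeff, natDegree_jacobiPolyShifted hα hβ,
    coeff_jacobiPolyShifted, if_pos (by omega)]
  have := jacobiCoeff_self_pos hα hβ n
  positivity

theorem degree_jacobiPoly {α β : ℝ} (hα : -1 < α) (hβ : -1 < β) (n : ℕ) :
    (jacobiPoly α β n).degree = n := by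
  have h0 : jacobiPoly α β n ≠ 0 := leadingCoeff_ne_zero.mp (leadingCoeff_jacobiPoly_pos hα hβ n).ne'
  have e : (C (1 / 2) * (X - 1) : ℝ[X]) = C (1 / 2) * (X - C 1) := by simp
  rw [degree_eq_natDegree h0, jacobiPoly_eq_comp, natDegree_comp,
    natDegree_jacobiPolyShifted hα hβ, e, natDegree_C_mul (by norm_num), natDegree_X_sub_C, mul_one]

theorem jacobiPolyShifted_ode (α β : ℝ) (n : ℕ) :
    X * (1 + X) * derivative (derivative (jacobiPolyShifted α β n))
      + (C (α + 1) + C (α + β + 2) * X) * derivative (jacobiPolyShifted α β n)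
      = C (n * (n + α + β + 1)) * jacobiPolyShifted α β n := by
  set q := jacobiPolyShifted α β n
  have hX : ∀ (f : ℝ[X]) (l : ℕ), (X * derivative f).coeff l = l * f.coeff l := by
    intro f l
    rcases l with _ | l
    · simp
    · rw [coeff_X_mul, coeff_derivative]; push_cast; ring
  -- written with the Euler operator `X d/dX`, the left side has readable coefficients
  have e : X * (1 + X) * derivative (derivative q) + (C (α + 1) + C (α + β + 2) * X) * derivative q
      = X * derivative (X * derivative q) + derivative (X * derivative q)
        + C (α + β + 1) * (X * derivative q) + C α * derivative q := by
    rw [derivative_mul, derivative_X]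
    simp only [map_add, map_one, map_ofNat]
    ring
  rw [e]
  ext l
  simp only [coeff_add, coeff_C_mul, hX, coeff_derivative]
  have hc : ∀ l, q.coeff l = if l < n + 1 then jacobiCoeff α β n l else 0 :=
    coeff_jacobiPolyShifted α β n
  rcases lt_trichotomy l n with h | h | h
  · rw [hc l, hc (l + 1), if_pos (by omega), if_pos (by omega)]
    have := jacobiCoeff_succ α β h
    push_cast
    linear_combination this
  · rw [hc l, hc (l + 1), if_pos (by omega), if_neg (by omega), h]
    push_cast
    ring
  · rw [hc l, hc (l + 1), if_neg (by omega), if_neg (by omega)]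
    ring

/-- The Jacobi differential equation. -/
theorem jacobiPoly_ode (α β : ℝ) (n : ℕ) (t : ℝ) :
    (1 - t ^ 2) * (derivative (derivative (jacobiPoly α β n))).eval t
      + (β - α - (α + β + 2) * t) * (derivative (jacobiPoly α β n)).eval t
      = -(n * (n + α + β + 1)) * (jacobiPoly α β n).eval t := by
  have h := congrArg (eval ((t - 1) / 2)) (jacobiPolyShifted_ode α β n)
  simp only [eval_add, eval_mul, eval_X, eval_C, eval_one] at h
  have hu : derivative (C (1 / 2) * (X - 1) : ℝ[X]) = C (1 / 2) := by simp
  have hv : eval t (C (1 / 2) * (X - 1) : ℝ[X]) = (t - 1) / 2 := by simp; ring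
  rw [jacobiPoly_eq_comp]
  simp only [derivative_comp, hu, derivative_mul, derivative_C, eval_mul, eval_add, eval_comp, hv,
    eval_C, eval_zero]
  linear_combination -h

/-! ### Orthogonality of the Jacobi polynomials -/

/-- The Jacobi weight `(1-t)^α (1+t)^β`. -/
noncomputable def jacobiWeight (α β t : ℝ) : ℝ := (1 - t) ^ α * (1 + t) ^ β

theorem jacobiWeight_pos (α β : ℝ) {t : ℝ} (ht : t ∈ Ioo (-1 : ℝ) 1) : 0 < jacobiWeight α β t :=
  mul_pos (Real.rpow_pos_of_pos (by linarith [ht.2]) _) (Real.rpow_pos_of_pos (by linarith [ht.1]) _)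

theorem integrableOn_jacobiWeight {α β : ℝ} (hα : -1 < α) (hβ : -1 < β) :
    IntegrableOn (jacobiWeight α β) (Ioo (-1) 1) := by
  have h1 : IntervalIntegrable (jacobiWeight α β) volume (-1) 0 := by
    have hi : IntervalIntegrable (fun t : ℝ => (1 + t) ^ β) volume (-1) 0 := by
      have := (intervalIntegral.intervalIntegrable_rpow' (a := 0) (b := 1) hβ).comp_add_left 1
      simpa using this
    refine hi.continuousOn_mul (g := fun t : ℝ => (1 - t) ^ α) ?_
    refine ContinuousOn.rpow_const (by fun_prop) fun t ht => Or.inl ?_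
    rw [uIcc_of_le (by norm_num)] at ht
    linarith [ht.2]
  have h2 : IntervalIntegrable (jacobiWeight α β) volume 0 1 := by
    have hi : IntervalIntegrable (fun t : ℝ => (1 - t) ^ α) volume 0 1 := by
      have := (intervalIntegral.intervalIntegrable_rpow' (a := 0) (b := 1) hα).comp_sub_left 1
      simpa using this.symm
    refine hi.mul_continuousOn (g := fun t : ℝ => (1 + t) ^ β) ?_
    refine ContinuousOn.rpow_const (by fun_prop) fun t ht => Or.inl ?_
    rw [uIcc_of_le (by norm_num)] at ht
    linarith [ht.1]
  exact ((intervalIntegrable_iff_integrableOn_Ioo_of_le (by norm_num)).mp (h1.trans h2))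

theorem integrable_eval_mul_jacobiWeight {α β : ℝ} (hα : -1 < α) (hβ : -1 < β) (p : ℝ[X]) :
    Integrable (fun t => p.eval (id t) * jacobiWeight α β t) (volume.restrict (Ioo (-1) 1)) :=
  integrable_eval_mul aestronglyMeasurable_id
    ((ae_restrict_mem measurableSet_Ioo).mono fun _ ht => Ioo_subset_Icc_self ht)
    (integrableOn_jacobiWeight hα hβ) p

/-- The linear functional of integration against the Jacobi weight. -/
noncomputable def jacobiFunctional {α β : ℝ} (hα : -1 < α) (hβ : -1 < β) : ℝ[X] →ₗ[ℝ] ℝ :=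
  weightedIntegral (volume.restrict (Ioo (-1) 1)) id (jacobiWeight α β)
    (integrable_eval_mul_jacobiWeight hα hβ)

theorem jacobiFunctional_apply {α β : ℝ} (hα : -1 < α) (hβ : -1 < β) (p : ℝ[X]) :
    jacobiFunctional hα hβ p = ∫ t in Ioo (-1 : ℝ) 1, p.eval t * jacobiWeight α β t := rfl

theorem jacobiFunctional_sq_pos {α β : ℝ} (hα : -1 < α) (hβ : -1 < β) {p : ℝ[X]} (hp : p ≠ 0) :
    0 < jacobiFunctional hα hβ (p * p) := by
  rw [jacobiFunctional_apply, setIntegral_pos_iff_support_of_nonneg_ae]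
  · have hsub : Ioo (-1 : ℝ) 1 \ ↑p.roots.toFinset ⊆
        Function.support (fun t => (p * p).eval t * jacobiWeight α β t) ∩ Ioo (-1) 1 := by
      intro t ht
      refine ⟨?_, ht.1⟩
      have h1 : p.eval t ≠ 0 := by
        intro h
        exact ht.2 (by simp [hp, h])
      rw [Function.mem_support, eval_mul]
      exact mul_ne_zero (mul_ne_zero h1 h1) (jacobiWeight_pos α β ht.1).ne'
    refine lt_of_lt_of_le ?_ (measure_mono hsub)
    rw [measure_sdiff_null (Finset.measure_zero _ _)]
    simp
  · refine (ae_restrict_mem measurableSet_Ioo).mono fun t ht => ?_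
    simp only [eval_mul, Pi.zero_apply]
    exact mul_nonneg (mul_self_nonneg _) (jacobiWeight_pos α β ht).le
  · exact integrable_eval_mul_jacobiWeight hα hβ (p * p)

/-- The integral over `(-1,1)` of the derivative of `(1-t)^{α+1} (1+t)^{β+1} f(t)` vanishes. -/
theorem jacobiFunctional_divergence {α β : ℝ} (hα : -1 < α) (hβ : -1 < β) (f : ℝ[X]) :
    jacobiFunctional hα hβ
      ((1 - X ^ 2) * derivative f + (C (β - α) - C (α + β + 2) * X) * f) = 0 := by
  rw [jacobiFunctional_apply, ← integral_Ioc_eq_integral_Ioo,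
    ← intervalIntegral.integral_of_le (by norm_num)]
  have hα1 : α + 1 ≠ 0 := by linarith
  have hβ1 : β + 1 ≠ 0 := by linarith
  rw [intervalIntegral.integral_eq_sub_of_hasDerivAt_of_le (by norm_num)
    (f := fun t => (1 - t) ^ (α + 1) * (1 + t) ^ (β + 1) * f.eval t)]
  · simp [Real.zero_rpow hα1, Real.zero_rpow hβ1]
  · refine ContinuousOn.mul (ContinuousOn.mul ?_ ?_) f.continuous.continuousOn
    · exact ContinuousOn.rpow_const (by fun_prop) fun t _ => Or.inr (by linarith)
    · exact ContinuousOn.rpow_const (by fun_prop) fun t _ => Or.inr (by linarith)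
  · intro t ht
    have h1 : (0 : ℝ) < 1 - t := by linarith [ht.2]
    have h2 : (0 : ℝ) < 1 + t := by linarith [ht.1]
    have d1 := ((hasDerivAt_id t).const_sub 1).rpow_const (p := α + 1) (Or.inl h1.ne')
    have d2 := ((hasDerivAt_id t).const_add 1).rpow_const (p := β + 1) (Or.inl h2.ne')
    have d := (d1.mul d2).mul (f.hasDerivAt t)
    refine d.congr_deriv ?_
    simp only [id, add_sub_cancel_right, Pi.mul_apply]
    rw [Real.rpow_add_one h1.ne', Real.rpow_add_one h2.ne', jacobiWeight]
    simp only [eval_add, eval_mul, eval_sub, eval_one, eval_pow, eval_X, eval_C]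
    ring
  · exact (intervalIntegrable_iff_integrableOn_Ioo_of_le (by norm_num)).mpr
      (integrable_eval_mul_jacobiWeight hα hβ _)

/-- The Wronskian-type polynomial `P' Q - P Q'` turns the differential equations of `P` and `Q` into
a divergence, with the difference of the eigenvalues in front of `P Q`. -/
theorem jacobiFunctional_jacobiPoly_mul_of_ne {α β : ℝ} (hα : -1 < α) (hβ : -1 < β) {m n : ℕ}
    (hmn : m ≠ n) : jacobiFunctional hα hβ (jacobiPoly α β m * jacobiPoly α β n) = 0 := by
  set P := jacobiPoly α β m with hP
  set Q := jacobiPoly α β n with hQ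
  have h := jacobiFunctional_divergence hα hβ (derivative P * Q - P * derivative Q)
  have e : (1 - X ^ 2) * derivative (derivative P * Q - P * derivative Q)
        + (C (β - α) - C (α + β + 2) * X) * (derivative P * Q - P * derivative Q)
      = C (n * (n + α + β + 1) - m * (m + α + β + 1) : ℝ) * (P * Q) := by
    refine Polynomial.funext fun t => ?_
    have h1 := jacobiPoly_ode α β m t
    have h2 := jacobiPoly_ode α β n t
    rw [← hP] at h1
    rw [← hQ] at h2
    simp only [derivative_sub, derivative_mul, eval_add, eval_mul, eval_sub, eval_one, eval_pow,
      eval_X, eval_C]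
    linear_combination Q.eval t * h1 - P.eval t * h2
  rw [e, C_mul', map_smul, smul_eq_mul] at h
  refine (mul_eq_zero.mp h).resolve_left ?_
  rw [show (n * (n + α + β + 1) - m * (m + α + β + 1) : ℝ) = (n - m) * (n + m + α + β + 1) by ring]
  have h1 : (n : ℝ) - m ≠ 0 := sub_ne_zero.mpr (by exact_mod_cast hmn.symm)
  have h2 : (1 : ℝ) ≤ n + m := by
    have : 1 ≤ n + m := by omega
    exact_mod_cast this
  exact mul_ne_zero h1 (by linarith)

theorem jacobiNormSq_eq {α β : ℝ} (hα : -1 < α) (hβ : -1 < β) (m : ℕ) :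
    jacobiNormSq α β m = jacobiFunctional hα hβ (jacobiPoly α β m * jacobiPoly α β m) := by
  rw [jacobiNormSq, jacobiFunctional_apply]
  refine integral_congr_ae (Filter.Eventually.of_forall fun t => ?_)
  simp only [jacobiWeight, eval_mul]
  ring

theorem jacobiNormSq_pos {α β : ℝ} (hα : -1 < α) (hβ : -1 < β) (m : ℕ) :
    0 < jacobiNormSq α β m := by
  rw [jacobiNormSq_eq hα hβ]
  exact jacobiFunctional_sq_pos hα hβ
    (leadingCoeff_ne_zero.mp (leadingCoeff_jacobiPoly_pos hα hβ m).ne')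

/-- The orthonormal Jacobi polynomial `P_m^{(α,β)} / √g_m^{(α,β)}`. -/
noncomputable def jacobiOrthonormal (α β : ℝ) (m : ℕ) : ℝ[X] :=
  C (1 / √(jacobiNormSq α β m)) * jacobiPoly α β m

theorem eval_jacobiOrthonormal (α β : ℝ) (m : ℕ) (t : ℝ) : (jacobiOrthonormal α β m).eval t
    = 1 / √(jacobiNormSq α β m) * (jacobiPoly α β m).eval t := by
  simp [jacobiOrthonormal]

theorem degree_jacobiOrthonormal {α β : ℝ} (hα : -1 < α) (hβ : -1 < β) (m : ℕ) :
    (jacobiOrthonormal α β m).degree = m := by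
  have := Real.sqrt_pos.mpr (jacobiNormSq_pos hα hβ m)
  rw [jacobiOrthonormal, degree_C_mul (by positivity), degree_jacobiPoly hα hβ]

theorem leadingCoeff_jacobiOrthonormal_pos {α β : ℝ} (hα : -1 < α) (hβ : -1 < β) (m : ℕ) :
    0 < (jacobiOrthonormal α β m).leadingCoeff := by
  have := Real.sqrt_pos.mpr (jacobiNormSq_pos hα hβ m)
  have := leadingCoeff_jacobiPoly_pos hα hβ m
  rw [jacobiOrthonormal, leadingCoeff_mul, leadingCoeff_C]
  positivity

theorem jacobiFunctional_jacobiOrthonormal {α β : ℝ} (hα : -1 < α) (hβ : -1 < β) (m n : ℕ) :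
    jacobiFunctional hα hβ (jacobiOrthonormal α β m * jacobiOrthonormal α β n)
      = if m = n then 1 else 0 := by
  have e : jacobiOrthonormal α β m * jacobiOrthonormal α β n
      = C (1 / √(jacobiNormSq α β m) * (1 / √(jacobiNormSq α β n)))
        * (jacobiPoly α β m * jacobiPoly α β n) := by
    rw [jacobiOrthonormal, jacobiOrthonormal, C_mul]; ring
  rw [e, C_mul', map_smul, smul_eq_mul]
  split_ifs with h
  · subst h
    have := jacobiNormSq_pos hα hβ m
    rw [← jacobiNormSq_eq]
    have h1 := Real.mul_self_sqrt this.le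
    have h2 := (Real.sqrt_pos.mpr this).ne'
    field_simp
    linarith
  · rw [jacobiFunctional_jacobiPoly_mul_of_ne hα hβ h, mul_zero]

/-! ### The quadratic transformation of the ultraspherical polynomials -/

/-- The substitution `s = 2t² - 1` on `(0,1)`. -/
theorem integral_jacobiWeight_comp_two_mul_sq_sub_one (α : ℝ) (f : ℝ → ℝ) :
    ∫ s in Ioo (-1 : ℝ) 1, f s * jacobiWeight α (-1 / 2) s
      = 2 * (2 : ℝ) ^ (α + 1 / 2)
        * ∫ t in Ioo (0 : ℝ) 1, f (2 * t ^ 2 - 1) * jacobiWeight α α t := by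
  have himg : (fun t : ℝ => 2 * t ^ 2 - 1) '' Ioo 0 1 = Ioo (-1) 1 := by
    ext s
    constructor
    · rintro ⟨t, ht, rfl⟩
      constructor <;> nlinarith [ht.1, ht.2]
    · intro hs
      have h0 : 0 < (1 + s) / 2 := by linarith [hs.1]
      refine ⟨√((1 + s) / 2), ⟨Real.sqrt_pos.mpr h0, ?_⟩, ?_⟩
      · rw [Real.sqrt_lt' one_pos]; linarith [hs.2]
      · simp only [Real.sq_sqrt h0.le]; ring
  have hinj : InjOn (fun t : ℝ => 2 * t ^ 2 - 1) (Ioo 0 1) := by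
    intro a ha b hb h
    have : (a - b) * (a + b) = 0 := by simp only at h; linarith
    rcases mul_eq_zero.mp this with h | h
    · linarith
    · linarith [ha.1, hb.1]
  rw [← himg, integral_image_eq_integral_abs_deriv_smul (f' := fun t => 4 * t) measurableSet_Ioo
    (fun t _ => ?_) hinj, ← integral_const_mul]
  · refine setIntegral_congr_fun measurableSet_Ioo fun t ht => ?_
    have ht0 : 0 < t := ht.1
    have h1 : 0 < 1 - t := by linarith [ht.2]
    have h2 : 0 < 1 + t := by linarith
    have e1 : 1 - (2 * t ^ 2 - 1) = 2 * ((1 - t) * (1 + t)) := by ring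
    have e2 : 1 + (2 * t ^ 2 - 1) = 2 * (t * t) := by ring
    have e3 : (t * t) ^ (-1 / 2 : ℝ) = t⁻¹ := by
      rw [Real.mul_rpow ht0.le ht0.le, ← Real.rpow_add ht0]
      norm_num [Real.rpow_neg_one]
    have e4 : (2 : ℝ) * 2 ^ (α + 1 / 2) = 4 * (2 ^ α * 2 ^ (-1 / 2 : ℝ)) := by
      rw [← Real.rpow_add two_pos, show α + 1 / 2 = (α + -1 / 2) + 1 by ring,
        Real.rpow_add_one two_ne_zero]
      ring
    simp only [jacobiWeight, smul_eq_mul]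
    rw [e1, e2, Real.mul_rpow two_pos.le (by positivity), Real.mul_rpow h1.le h2.le,
      Real.mul_rpow two_pos.le (by positivity), e3, e4, abs_of_pos (by linarith)]
    field_simp
  · have := (((hasDerivAt_pow 2 t).const_mul 2).sub_const 1).hasDerivWithinAt (s := Ioo 0 1)
    refine this.congr_deriv ?_
    norm_num; ring

theorem jacobiWeight_neg (α t : ℝ) : jacobiWeight α α (-t) = jacobiWeight α α t := by
  simp only [jacobiWeight]
  rw [mul_comm]
  simp [sub_eq_add_neg]

theorem jacobiFunctional_comp_neg {α : ℝ} (hα : -1 < α) (p : ℝ[X]) :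
    jacobiFunctional hα hα (p.comp (-X)) = jacobiFunctional hα hα p := by
  simp only [jacobiFunctional_apply]
  rw [← integral_Ioc_eq_integral_Ioo, ← integral_Ioc_eq_integral_Ioo,
    ← intervalIntegral.integral_of_le (by norm_num), ← intervalIntegral.integral_of_le (by norm_num)]
  have := intervalIntegral.integral_comp_neg (a := -1) (b := 1)
    (fun t => p.eval t * jacobiWeight α α t)
  rw [neg_neg] at this
  rw [← this]
  simp [eval_comp, jacobiWeight_neg]

theorem jacobiFunctional_eq_zero_of_odd {α : ℝ} (hα : -1 < α) {p : ℝ[X]} (hp : p.comp (-X) = -p) :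
    jacobiFunctional hα hα p = 0 := by
  have h := jacobiFunctional_comp_neg hα p
  rw [hp, map_neg] at h
  linarith

theorem jacobiFunctional_comp_two_mul_sq_sub_one {α : ℝ} (hα : -1 < α) (hβ : (-1 : ℝ) < -1 / 2)
    (f : ℝ[X]) : (2 : ℝ) ^ (α + 1 / 2) * jacobiFunctional hα hα (f.comp (2 * X ^ 2 - 1))
      = jacobiFunctional hα hβ f := by
  have hi := (intervalIntegrable_iff_integrableOn_Ioo_of_le (by norm_num)).mpr
    (integrable_eval_mul_jacobiWeight hα hα (f.comp (2 * X ^ 2 - 1)))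
  simp only [id] at hi
  set F : ℝ → ℝ := fun t => (f.comp (2 * X ^ 2 - 1)).eval t * jacobiWeight α α t with hF
  have h1 : jacobiFunctional hα hα (f.comp (2 * X ^ 2 - 1)) = 2 * ∫ t in Ioo (0 : ℝ) 1, F t := by
    have hl : ∫ t in (-1 : ℝ)..0, F t = ∫ t in (0 : ℝ)..1, F t := by
      have := intervalIntegral.integral_comp_neg (a := 0) (b := 1) F
      rw [neg_zero] at this
      rw [← this]
      simp [hF, eval_comp, jacobiWeight_neg]
    rw [jacobiFunctional_apply, ← integral_Ioc_eq_integral_Ioo, ← integral_Ioc_eq_integral_Ioo,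
      ← intervalIntegral.integral_of_le (by norm_num),
      ← intervalIntegral.integral_of_le (by norm_num),
      ← intervalIntegral.integral_add_adjacent_intervals (b := 0) (hi.mono_set ?_)
        (hi.mono_set ?_), hl]
    · ring
    · rw [uIcc_of_le (by norm_num), uIcc_of_le (by norm_num)]
      exact Icc_subset_Icc le_rfl (by norm_num)
    · rw [uIcc_of_le (by norm_num), uIcc_of_le (by norm_num)]
      exact Icc_subset_Icc (by norm_num) le_rfl
  rw [h1, jacobiFunctional_apply hα hβ, integral_jacobiWeight_comp_two_mul_sq_sub_one]
  simp only [hF, eval_comp, eval_sub, eval_mul, eval_pow, eval_X, eval_one, eval_ofNat]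
  ring

theorem jacobiFunctional_X_sq_mul_comp_two_mul_sq_sub_one {α : ℝ} (hα : -1 < α)
    (hβ : (-1 : ℝ) < 1 / 2) (f : ℝ[X]) :
    (2 : ℝ) ^ (α + 3 / 2) * jacobiFunctional hα hα (X ^ 2 * f.comp (2 * X ^ 2 - 1))
      = jacobiFunctional hα hβ f := by
  have e : X ^ 2 * f.comp (2 * X ^ 2 - 1) = (C (1 / 2) * (1 + X) * f).comp (2 * X ^ 2 - 1) := by
    refine Polynomial.funext fun t => ?_
    simp [eval_comp]
  rw [e, show α + 3 / 2 = (α + 1 / 2) + 1 by ring, Real.rpow_add_one two_ne_zero, mul_comm _ (2 : ℝ),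
    mul_assoc, jacobiFunctional_comp_two_mul_sq_sub_one hα (by norm_num), jacobiFunctional_apply,
    jacobiFunctional_apply, ← integral_const_mul]
  refine setIntegral_congr_fun measurableSet_Ioo fun t ht => ?_
  have h2 : 0 < 1 + t := by linarith [ht.1]
  simp only [jacobiWeight, eval_mul, eval_C, eval_add, eval_one, eval_X]
  rw [show (1 / 2 : ℝ) = -1 / 2 + 1 by norm_num, Real.rpow_add_one h2.ne',
    show (-1 / 2 + 1 : ℝ) = 1 / 2 by norm_num]
  ring

/-- The orthonormal polynomials for the weight `(1-t²)^α`, assembled from the Jacobi polynomials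
with second parameter `∓1/2` in the variable `2t² - 1`. -/
noncomputable def quadraticJacobi (α : ℝ) (m : ℕ) : ℝ[X] :=
  if Even m then
    C ((2 : ℝ) ^ ((2 * α + 1) / 4)) * (jacobiOrthonormal α (-1 / 2) (m / 2)).comp (2 * X ^ 2 - 1)
  else
    C ((2 : ℝ) ^ ((2 * α + 3) / 4)) *
      (X * (jacobiOrthonormal α (1 / 2) (m / 2)).comp (2 * X ^ 2 - 1))

theorem quadraticJacobi_two_mul (α : ℝ) (k : ℕ) : quadraticJacobi α (2 * k)
    = C ((2 : ℝ) ^ ((2 * α + 1) / 4)) * (jacobiOrthonormal α (-1 / 2) k).comp (2 * X ^ 2 - 1) := by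
  rw [quadraticJacobi, if_pos (even_two_mul k), Nat.mul_div_cancel_left k two_pos]

theorem quadraticJacobi_two_mul_add_one (α : ℝ) (k : ℕ) : quadraticJacobi α (2 * k + 1)
    = C ((2 : ℝ) ^ ((2 * α + 3) / 4)) *
      (X * (jacobiOrthonormal α (1 / 2) k).comp (2 * X ^ 2 - 1)) := by
  rw [quadraticJacobi, if_neg (by simp), show (2 * k + 1) / 2 = k by omega]

theorem natDegree_two_mul_X_sq_sub_one : (2 * X ^ 2 - 1 : ℝ[X]).natDegree = 2 := by
  rw [← C_ofNat, ← C_1]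
  compute_degree!

theorem leadingCoeff_two_mul_X_sq_sub_one : (2 * X ^ 2 - 1 : ℝ[X]).leadingCoeff = 2 := by
  rw [leadingCoeff, natDegree_two_mul_X_sq_sub_one, ← C_ofNat, ← C_1, coeff_sub, coeff_C_mul,
    coeff_X_pow, coeff_C]
  norm_num

theorem leadingCoeff_quadraticJacobi_pos {α : ℝ} (hα : -1 < α) (m : ℕ) :
    0 < (quadraticJacobi α m).leadingCoeff := by
  rcases Nat.even_or_odd' m with ⟨k, rfl | rfl⟩
  · have := leadingCoeff_jacobiOrthonormal_pos hα (show (-1 : ℝ) < -1 / 2 by norm_num) k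
    rw [quadraticJacobi_two_mul, leadingCoeff_mul, leadingCoeff_C,
      leadingCoeff_comp (by rw [natDegree_two_mul_X_sq_sub_one]; norm_num),
      leadingCoeff_two_mul_X_sq_sub_one]
    positivity
  · have := leadingCoeff_jacobiOrthonormal_pos hα (show (-1 : ℝ) < 1 / 2 by norm_num) k
    rw [quadraticJacobi_two_mul_add_one, leadingCoeff_mul, leadingCoeff_C, leadingCoeff_mul,
      leadingCoeff_comp (by rw [natDegree_two_mul_X_sq_sub_one]; norm_num),
      leadingCoeff_two_mul_X_sq_sub_one, leadingCoeff_X]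
    positivity

theorem degree_quadraticJacobi {α : ℝ} (hα : -1 < α) (m : ℕ) :
    (quadraticJacobi α m).degree = m := by
  have h0 := leadingCoeff_ne_zero.mp (leadingCoeff_quadraticJacobi_pos hα m).ne'
  rw [degree_eq_natDegree h0]
  rcases Nat.even_or_odd' m with ⟨k, rfl | rfl⟩
  · rw [quadraticJacobi_two_mul, natDegree_C_mul (by positivity), natDegree_comp,
      natDegree_two_mul_X_sq_sub_one, natDegree_eq_of_degree_eq_some
        (degree_jacobiOrthonormal hα (by norm_num) k), mul_comm]
  · rw [quadraticJacobi_two_mul_add_one] at h0 ⊢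
    rw [natDegree_C_mul (by positivity), natDegree_mul X_ne_zero
      (right_ne_zero_of_mul (right_ne_zero_of_mul h0)), natDegree_comp, natDegree_X,
      natDegree_two_mul_X_sq_sub_one, natDegree_eq_of_degree_eq_some
        (degree_jacobiOrthonormal hα (by norm_num) k), mul_comm, add_comm]

theorem quadraticJacobi_comp_neg (α : ℝ) (m : ℕ) :
    (quadraticJacobi α m).comp (-X) = C ((-1) ^ m) * quadraticJacobi α m := by
  refine Polynomial.funext fun t => ?_
  rcases Nat.even_or_odd' m with ⟨k, rfl | rfl⟩
  · rw [quadraticJacobi_two_mul]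
    simp [eval_comp]
  · rw [quadraticJacobi_two_mul_add_one]
    simp [eval_comp, pow_succ]

theorem jacobiFunctional_quadraticJacobi {α : ℝ} (hα : -1 < α) (m n : ℕ) :
    jacobiFunctional hα hα (quadraticJacobi α m * quadraticJacobi α n)
      = if m = n then 1 else 0 := by
  by_cases hpar : Even (m + n)
  · rcases Nat.even_or_odd' m with ⟨k, rfl | rfl⟩ <;> rcases Nat.even_or_odd' n with ⟨l, rfl | rfl⟩
    · have hc : (2 : ℝ) ^ ((2 * α + 1) / 4) * (2 : ℝ) ^ ((2 * α + 1) / 4) = 2 ^ (α + 1 / 2) := by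
        rw [← Real.rpow_add two_pos]; congr 1; ring
      have e : quadraticJacobi α (2 * k) * quadraticJacobi α (2 * l) = C ((2 : ℝ) ^ (α + 1 / 2)) *
          (jacobiOrthonormal α (-1 / 2) k * jacobiOrthonormal α (-1 / 2) l).comp
            (2 * X ^ 2 - 1) := by
        rw [quadraticJacobi_two_mul, quadraticJacobi_two_mul, mul_comp, ← hc, C_mul]; ring
      rw [e, C_mul', map_smul, smul_eq_mul,
        jacobiFunctional_comp_two_mul_sq_sub_one hα (by norm_num),
        jacobiFunctional_jacobiOrthonormal]
      simp
    · exact absurd hpar (by grind)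
    · exact absurd hpar (by grind)
    · have hc : (2 : ℝ) ^ ((2 * α + 3) / 4) * (2 : ℝ) ^ ((2 * α + 3) / 4) = 2 ^ (α + 3 / 2) := by
        rw [← Real.rpow_add two_pos]; congr 1; ring
      have e : quadraticJacobi α (2 * k + 1) * quadraticJacobi α (2 * l + 1)
          = C ((2 : ℝ) ^ (α + 3 / 2)) *
          (X ^ 2 * (jacobiOrthonormal α (1 / 2) k * jacobiOrthonormal α (1 / 2) l).comp
            (2 * X ^ 2 - 1)) := by
        rw [quadraticJacobi_two_mul_add_one, quadraticJacobi_two_mul_add_one, mul_comp, ← hc, C_mul]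
        ring
      rw [e, C_mul', map_smul, smul_eq_mul,
        jacobiFunctional_X_sq_mul_comp_two_mul_sq_sub_one hα (by norm_num),
        jacobiFunctional_jacobiOrthonormal]
      simp
  · have hmn : m ≠ n := by rintro rfl; exact hpar ⟨m, rfl⟩
    rw [if_neg hmn]
    apply jacobiFunctional_eq_zero_of_odd
    rw [mul_comp, quadraticJacobi_comp_neg, quadraticJacobi_comp_neg]
    have : ((-1 : ℝ) ^ m) * (-1) ^ n = -1 := by
      rw [← pow_add]; exact (Nat.not_even_iff_odd.mp hpar).neg_one_pow
    calc _ = C ((-1 : ℝ) ^ m * (-1) ^ n) * (quadraticJacobi α m * quadraticJacobi α n) := by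
          rw [C_mul]; ring
      _ = _ := by rw [this]; simp

theorem quadraticJacobi_eq {α : ℝ} (hα : -1 < α) (m : ℕ) :
    quadraticJacobi α m = jacobiOrthonormal α α m :=
  eq_of_orthonormal_of_leadingCoeff_mul_pos (degree_jacobiOrthonormal hα hα)
    (degree_quadraticJacobi hα) (jacobiFunctional_jacobiOrthonormal hα hα)
    (jacobiFunctional_quadraticJacobi hα)
    (mul_pos (leadingCoeff_jacobiOrthonormal_pos hα hα m) (leadingCoeff_quadraticJacobi_pos hα m))

theorem Real.one_sub_tanh_mul_one_add_tanh (x : ℝ) :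
    (1 - Real.tanh x) * (1 + Real.tanh x) = (Real.cosh x ^ 2)⁻¹ := by
  have := Real.cosh_pos x
  rw [Real.tanh_eq_sinh_div_cosh]
  field_simp
  linear_combination Real.cosh_sq x

theorem Real.one_sub_tanh_rpow_mul_one_add_tanh_rpow (γ x : ℝ) :
    (1 - Real.tanh x) ^ (γ / 2) * (1 + Real.tanh x) ^ (γ / 2) = Real.cosh x ^ (-γ) := by
  have h := Real.cosh_pos x
  rw [← Real.mul_rpow (by linarith [Real.tanh_lt_one x]) (by linarith [Real.neg_one_lt_tanh x]),
    Real.one_sub_tanh_mul_one_add_tanh, ← Real.rpow_natCast, ← Real.rpow_neg h.le,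
    ← Real.rpow_mul h.le]
  congr 1
  push_cast
  ring

theorem tanhJacobi_eq (α : ℝ) (m : ℕ) (x : ℝ) : tanhJacobi α α m x
    = (-1) ^ m * (Real.cosh x ^ (-(α + 1)) * (jacobiOrthonormal α α m).eval (Real.tanh x)) := by
  rw [tanhJacobi, eval_jacobiOrthonormal, ← Real.one_sub_tanh_rpow_mul_one_add_tanh_rpow]
  ring

theorem two_mul_tanh_sq_sub_one (x : ℝ) : 2 * Real.tanh x ^ 2 - 1 = 1 - 2 / Real.cosh x ^ 2 := by
  have h := Real.one_sub_tanh_mul_one_add_tanh x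
  rw [div_eq_mul_inv, ← h]
  ring

theorem halfRangeEven_eq (α : ℝ) (m : ℕ) (x : ℝ) : halfRangeEven α m x
    = (2 : ℝ) ^ ((2 * α + 1) / 4) * (Real.cosh x ^ (-(α + 1))
      * (jacobiOrthonormal α (-1 / 2) m).eval (2 * Real.tanh x ^ 2 - 1)) := by
  rw [halfRangeEven, two_mul_tanh_sq_sub_one, eval_jacobiOrthonormal,
    Real.rpow_neg (Real.cosh_pos x).le, add_comm 1 α]
  ring

theorem halfRangeOdd_eq (α : ℝ) (m : ℕ) (x : ℝ) : halfRangeOdd α m x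
    = -((2 : ℝ) ^ ((2 * α + 3) / 4) * (Real.cosh x ^ (-(α + 1)) * Real.tanh x
      * (jacobiOrthonormal α (1 / 2) m).eval (2 * Real.tanh x ^ 2 - 1))) := by
  have h := Real.cosh_pos x
  rw [halfRangeOdd, two_mul_tanh_sq_sub_one, eval_jacobiOrthonormal,
    Real.rpow_neg h.le, show 2 + α = (α + 1) + 1 by ring, Real.rpow_add_one h.ne',
    Real.tanh_eq_sinh_div_cosh]
  have := (Real.rpow_pos_of_pos h (α + 1)).ne'
  field_simp

theorem halfRangeJacobi_two_mul (α : ℝ) (k : ℕ) (x : ℝ) :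
    halfRangeJacobi α (2 * k) x = halfRangeEven α k x := by
  rw [halfRangeJacobi, if_pos (even_two_mul k), Nat.mul_div_cancel_left k two_pos]

theorem halfRangeJacobi_two_mul_add_one (α : ℝ) (k : ℕ) (x : ℝ) :
    halfRangeJacobi α (2 * k + 1) x = halfRangeOdd α k x := by
  rw [halfRangeJacobi, if_neg (by simp), show (2 * k + 1) / 2 = k by omega]

theorem halfRangeJacobi_eq {α : ℝ} (hα : -1 < α) (m : ℕ) (x : ℝ) : halfRangeJacobi α m x
    = (-1) ^ m * (Real.cosh x ^ (-(α + 1)) * (jacobiOrthonormal α α m).eval (Real.tanh x)) := by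
  rw [← quadraticJacobi_eq hα]
  rcases Nat.even_or_odd' m with ⟨k, rfl | rfl⟩
  · rw [halfRangeJacobi_two_mul, halfRangeEven_eq, quadraticJacobi_two_mul]
    simp only [eval_mul, eval_comp, eval_C, eval_sub, eval_pow, eval_X, eval_ofNat, eval_one,
      (even_two_mul k).neg_one_pow]
    ring
  · rw [halfRangeJacobi_two_mul_add_one, halfRangeOdd_eq, quadraticJacobi_two_mul_add_one]
    simp only [eval_mul, eval_comp, eval_C, eval_sub, eval_pow, eval_X, eval_ofNat, eval_one,
      (odd_two_mul_add_one k).neg_one_pow]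
    ring

theorem halfRangeJacobi_eq_tanhJacobi {α : ℝ} (hα : -1 < α) (m : ℕ) (x : ℝ) :
    halfRangeJacobi α m x = tanhJacobi α α m x := by
  rw [halfRangeJacobi_eq hα, tanhJacobi_eq]

/-! ### The half-range family on the line -/

theorem Real.hasDerivAt_tanh (x : ℝ) : HasDerivAt Real.tanh (1 - Real.tanh x ^ 2) x := by
  have h := Real.cosh_pos x
  have e : Real.tanh = fun x => Real.sinh x / Real.cosh x := funext Real.tanh_eq_sinh_div_cosh
  rw [e]
  refine ((Real.hasDerivAt_sinh x).div (Real.hasDerivAt_cosh x) h.ne').congr_deriv ?_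
  field_simp

theorem Real.continuous_tanh : Continuous Real.tanh :=
  continuous_iff_continuousAt.mpr fun x => (Real.hasDerivAt_tanh x).continuousAt

theorem Real.one_sub_tanh_sq_pos (x : ℝ) : 0 < 1 - Real.tanh x ^ 2 := by
  nlinarith [Real.neg_one_lt_tanh x, Real.tanh_lt_one x]

theorem abs_deriv_tanh_smul_jacobiWeight (α x y : ℝ) :
    |1 - Real.tanh x ^ 2| • (y * jacobiWeight α α (Real.tanh x))
      = y * Real.cosh x ^ (-(2 * (α + 1))) := by
  have h1 : 0 < 1 - Real.tanh x := by linarith [Real.tanh_lt_one x]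
  have h2 : 0 < 1 + Real.tanh x := by linarith [Real.neg_one_lt_tanh x]
  rw [← Real.one_sub_tanh_rpow_mul_one_add_tanh_rpow, abs_of_pos (Real.one_sub_tanh_sq_pos x),
    show 2 * (α + 1) / 2 = α + 1 by ring, Real.rpow_add_one h1.ne', Real.rpow_add_one h2.ne',
    jacobiWeight, smul_eq_mul]
  ring

theorem integrable_eval_tanh_mul_cosh_rpow {α : ℝ} (hα : -1 < α) (p : ℝ[X]) :
    Integrable fun x => p.eval (Real.tanh x) * Real.cosh x ^ (-(2 * (α + 1))) := by
  have h := integrable_eval_mul_jacobiWeight hα hα p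
  rw [← integrableOn_univ]
  have hi := integrableOn_image_iff_integrableOn_abs_deriv_smul (f := Real.tanh) (s := univ)
    MeasurableSet.univ (fun x _ => (Real.hasDerivAt_tanh x).hasDerivWithinAt)
    Real.tanh_injective.injOn (fun t => p.eval t * jacobiWeight α α t)
  rw [Real.tanh_bijOn.image_eq] at hi
  simp only [abs_deriv_tanh_smul_jacobiWeight] at hi
  exact hi.mp h

/-- The substitution `t = tanh x`. -/
theorem integral_eval_tanh_mul_cosh_rpow {α : ℝ} (hα : -1 < α) (p : ℝ[X]) :
    ∫ x, p.eval (Real.tanh x) * Real.cosh x ^ (-(2 * (α + 1))) = jacobiFunctional hα hα p := by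
  have hi := integral_image_eq_integral_abs_deriv_smul (f := Real.tanh) (s := univ)
    MeasurableSet.univ (fun x _ => (Real.hasDerivAt_tanh x).hasDerivWithinAt)
    Real.tanh_injective.injOn (fun t => p.eval t * jacobiWeight α α t)
  rw [Real.tanh_bijOn.image_eq] at hi
  simp only [abs_deriv_tanh_smul_jacobiWeight] at hi
  rw [jacobiFunctional_apply, hi, setIntegral_univ]

theorem hasDerivAt_cosh_rpow (γ x : ℝ) : HasDerivAt (fun x => Real.cosh x ^ γ)
    (γ * Real.tanh x * Real.cosh x ^ γ) x := by
  have h := Real.cosh_pos x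
  refine ((Real.hasDerivAt_cosh x).rpow_const (p := γ) (Or.inl h.ne')).congr_deriv ?_
  rw [Real.rpow_sub_one h.ne', Real.tanh_eq_sinh_div_cosh]
  ring

theorem continuous_halfRangeJacobi {α : ℝ} (hα : -1 < α) (m : ℕ) :
    Continuous (halfRangeJacobi α m) := by
  rw [funext (halfRangeJacobi_eq hα m)]
  refine continuous_const.mul (Continuous.mul ?_ ((Polynomial.continuous _).comp
    Real.continuous_tanh))
  exact continuous_iff_continuousAt.mpr fun x => (hasDerivAt_cosh_rpow _ x).continuousAt

theorem halfRangeJacobi_mul (α : ℝ) (hα : -1 < α) (m n : ℕ) (x : ℝ) :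
    halfRangeJacobi α m x * halfRangeJacobi α n x
      = (C ((-1) ^ m * (-1) ^ n) * (jacobiOrthonormal α α m * jacobiOrthonormal α α n)).eval
        (Real.tanh x) * Real.cosh x ^ (-(2 * (α + 1))) := by
  rw [halfRangeJacobi_eq hα, halfRangeJacobi_eq hα,
    show -(2 * (α + 1)) = -(α + 1) + -(α + 1) by ring, Real.rpow_add (Real.cosh_pos x)]
  simp only [eval_mul, eval_C]
  ring

theorem isOrthonormalSystem_halfRangeJacobi {α : ℝ} (hα : -1 < α) :
    IsOrthonormalSystem (halfRangeJacobi α) := by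
  refine ⟨fun m => ?_, fun m n => ?_⟩
  · rw [memLp_two_iff_integrable_sq (continuous_halfRangeJacobi hα m).aestronglyMeasurable]
    simp only [sq, halfRangeJacobi_mul α hα]
    exact integrable_eval_tanh_mul_cosh_rpow hα _
  · simp only [halfRangeJacobi_mul α hα]
    rw [integral_eval_tanh_mul_cosh_rpow hα, C_mul', map_smul, jacobiFunctional_jacobiOrthonormal]
    split_ifs with h
    · subst h
      rw [← mul_pow]; simp
    · simp

/-- Up to the common factor `(-1)^m cosh^{-(α+1)}`, the derivative of the `m`th function of the
half-range family, as a polynomial in `tanh`. -/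
noncomputable def halfRangeDerivPoly (α : ℝ) (m : ℕ) : ℝ[X] :=
  (1 - X ^ 2) * derivative (jacobiOrthonormal α α m)
    - C (α + 1) * (X * jacobiOrthonormal α α m)

theorem hasDerivAt_halfRangeJacobi {α : ℝ} (hα : -1 < α) (m : ℕ) (x : ℝ) :
    HasDerivAt (halfRangeJacobi α m) ((-1) ^ m * (Real.cosh x ^ (-(α + 1))
      * (halfRangeDerivPoly α m).eval (Real.tanh x))) x := by
  rw [funext (halfRangeJacobi_eq hα m)]
  refine (((hasDerivAt_cosh_rpow _ x).mul (((jacobiOrthonormal α α m).hasDerivAt _).comp x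
    (Real.hasDerivAt_tanh x))).const_mul ((-1) ^ m)).congr_deriv ?_
  simp only [halfRangeDerivPoly, eval_mul, eval_sub, eval_one, eval_pow, eval_X, eval_C,
    Function.comp_apply]
  ring

/-- The coefficients in degrees above `m`; only `l = m` gives a nonzero value. -/
theorem coeff_halfRangeDerivPoly {α : ℝ} (m l : ℕ) (hl : m ≤ l)
    (h : ∀ k, m < k → (jacobiOrthonormal α α m).coeff k = 0) :
    (halfRangeDerivPoly α m).coeff (l + 1)
      = -(l + (α + 1)) * (jacobiOrthonormal α α m).coeff l := by
  have e : halfRangeDerivPoly α m = derivative (jacobiOrthonormal α α m)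
      - X * (X * derivative (jacobiOrthonormal α α m))
      - C (α + 1) * (X * jacobiOrthonormal α α m) := by
    rw [halfRangeDerivPoly]; ring
  rw [e, coeff_sub, coeff_sub, coeff_X_mul, coeff_C_mul, coeff_X_mul, coeff_derivative,
    h (l + 1 + 1) (by omega)]
  rcases l with _ | l
  · simp
    ring
  · rw [coeff_X_mul, coeff_derivative]
    push_cast
    ring

theorem degree_halfRangeDerivPoly_lt {α : ℝ} (hα : -1 < α) (m : ℕ) :
    (halfRangeDerivPoly α m).degree < (m + 2 : ℕ) := by
  have h : ∀ k, m < k → (jacobiOrthonormal α α m).coeff k = 0 := fun k hk =>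
    coeff_eq_zero_of_degree_lt (by rw [degree_jacobiOrthonormal hα hα]; exact_mod_cast hk)
  rw [degree_lt_iff_coeff_zero]
  intro l hl
  obtain ⟨l, rfl⟩ : ∃ k, l = k + 1 := ⟨l - 1, by omega⟩
  rw [coeff_halfRangeDerivPoly m l (by omega) h, h l (by omega), mul_zero]

/-- The differentiation matrix of the half-range family. -/
noncomputable def halfRangeMatrix {α : ℝ} (hα : -1 < α) : Matrix ℕ ℕ ℝ := fun m k =>
  (-1) ^ m * (-1) ^ k * jacobiFunctional hα hα (halfRangeDerivPoly α m * jacobiOrthonormal α α k)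

theorem halfRangeMatrix_of_lt {α : ℝ} (hα : -1 < α) {m k : ℕ} (h : m + 1 < k) :
    halfRangeMatrix hα m k = 0 := by
  rw [halfRangeMatrix, functional_mul_eq_zero_of_degree_lt (degree_jacobiOrthonormal hα hα)
    (jacobiFunctional_jacobiOrthonormal hα hα)
    ((degree_halfRangeDerivPoly_lt hα m).trans_le (by exact_mod_cast h)), mul_zero]

/-- Integration by parts: the sum of the two entries is the integral of a derivative. -/
theorem halfRangeMatrix_swap {α : ℝ} (hα : -1 < α) (m k : ℕ) :
    halfRangeMatrix hα k m = -halfRangeMatrix hα m k := by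
  have h := jacobiFunctional_divergence hα hα (jacobiOrthonormal α α m * jacobiOrthonormal α α k)
  have e : (1 - X ^ 2) * derivative (jacobiOrthonormal α α m * jacobiOrthonormal α α k)
        + (C (α - α) - C (α + α + 2) * X) * (jacobiOrthonormal α α m * jacobiOrthonormal α α k)
      = halfRangeDerivPoly α m * jacobiOrthonormal α α k
        + halfRangeDerivPoly α k * jacobiOrthonormal α α m := by
    rw [halfRangeDerivPoly, halfRangeDerivPoly, show α + α + 2 = (α + 1) + (α + 1) by ring, C_add,
      derivative_mul, sub_self, C_0]
    ring
  rw [e, map_add] at h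
  rw [halfRangeMatrix, halfRangeMatrix]
  linear_combination ((-1) ^ m * (-1) ^ k) * h

theorem isTridiagonal_halfRangeMatrix {α : ℝ} (hα : -1 < α) :
    IsTridiagonal (halfRangeMatrix hα) := by
  rintro m k (h | h)
  · exact halfRangeMatrix_of_lt hα h
  · rw [halfRangeMatrix_swap, halfRangeMatrix_of_lt hα h, neg_zero]

theorem halfRangeMatrix_superdiagonal_pos {α : ℝ} (hα : -1 < α) (m : ℕ) :
    0 < halfRangeMatrix hα m (m + 1) := by
  have h : ∀ n k, n < k → (jacobiOrthonormal α α n).coeff k = 0 := fun n k hk =>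
    coeff_eq_zero_of_degree_lt (by rw [degree_jacobiOrthonormal hα hα]; exact_mod_cast hk)
  have hlc : ∀ n, 0 < (jacobiOrthonormal α α n).coeff n := fun n => by
    have := leadingCoeff_jacobiOrthonormal_pos hα hα n
    rwa [leadingCoeff, natDegree_eq_of_degree_eq_some (degree_jacobiOrthonormal hα hα n)] at this
  -- compare the coefficients of `X^(m+1)` in the expansion of the derivative
  have e := congrArg (fun f => f.coeff (m + 1)) (eq_sum_of_orthonormal
    (degree_jacobiOrthonormal hα hα) (jacobiFunctional_jacobiOrthonormal hα hα)
    (degree_halfRangeDerivPoly_lt hα m))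
  simp only [finsetSum_coeff, coeff_C_mul] at e
  rw [coeff_halfRangeDerivPoly m m le_rfl (h m), Finset.sum_range_succ, Finset.sum_eq_zero,
    zero_add] at e
  · have hs : ((-1 : ℝ) ^ m) * (-1) ^ (m + 1) = -1 := by
      rw [← pow_add, show m + (m + 1) = 2 * m + 1 by ring, (odd_two_mul_add_one m).neg_one_pow]
    rw [halfRangeMatrix, hs]
    have h1 : 0 < (m + (α + 1)) * (jacobiOrthonormal α α m).coeff m :=
      mul_pos (by have : (0 : ℝ) ≤ m := m.cast_nonneg
                  linarith) (hlc m)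
    have h2 := hlc (m + 1)
    refine (mul_pos_iff_of_pos_right h2).mp ?_
    linarith
  · intro k hk
    rw [h k (m + 1) (Finset.mem_range.mp hk), mul_zero]

theorem isDifferentiationMatrix_halfRangeMatrix {α : ℝ} (hα : -1 < α) :
    IsDifferentiationMatrix (halfRangeJacobi α) (halfRangeMatrix hα) := by
  intro m
  refine ⟨fun x => (hasDerivAt_halfRangeJacobi hα m x).differentiableAt, fun x => ?_⟩
  rw [(hasDerivAt_halfRangeJacobi hα m x).deriv]
  have e := congrArg (eval (Real.tanh x)) (eq_sum_of_orthonormal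
    (degree_jacobiOrthonormal hα hα) (jacobiFunctional_jacobiOrthonormal hα hα)
    (degree_halfRangeDerivPoly_lt hα m))
  have hs : (-1) ^ m * (Real.cosh x ^ (-(α + 1)) * (halfRangeDerivPoly α m).eval (Real.tanh x))
      = ∑ k ∈ Finset.range (m + 2), halfRangeMatrix hα m k * halfRangeJacobi α k x := by
    rw [e, eval_finsetSum, Finset.mul_sum, Finset.mul_sum]
    refine Finset.sum_congr rfl fun k _ => ?_
    have : ((-1 : ℝ) ^ k) * (-1) ^ k = 1 := by rw [← mul_pow]; simp
    rw [halfRangeMatrix, halfRangeJacobi_eq hα, eval_mul, eval_C]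
    linear_combination (-((-1) ^ m * Real.cosh x ^ (-(α + 1)) * (jacobiFunctional hα hα
      (halfRangeDerivPoly α m * jacobiOrthonormal α α k)
      * (jacobiOrthonormal α α k).eval (Real.tanh x)))) * this
  rw [hs]
  refine hasSum_sum_of_ne_finset_zero fun k hk => ?_
  rw [halfRangeMatrix_of_lt hα (by simp at hk; omega), zero_mul]

/-! ### Dilations and signs -/

/-- The system `ε_m √c ψ_m(cx)`. -/
noncomputable def dilatedSystem (ε : ℕ → ℝ) (c : ℝ) (ψ : ℕ → ℝ → ℝ) (m : ℕ) (x : ℝ) : ℝ :=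
  ε m * (√c * ψ m (c * x))

theorem sq_eq_one_of_sign {ε : ℝ} (h : ε = 1 ∨ ε = -1) : ε * ε = 1 := by
  rcases h with rfl | rfl <;> norm_num

theorem isOrthonormalSystem_dilatedSystem {ψ : ℕ → ℝ → ℝ} (h : IsOrthonormalSystem ψ) {c : ℝ}
    (hc : 0 < c) {ε : ℕ → ℝ} (hε : ∀ m, ε m = 1 ∨ ε m = -1) :
    IsOrthonormalSystem (dilatedSystem ε c ψ) := by
  refine ⟨fun m => ?_, fun m n => ?_⟩
  · refine MemLp.const_mul (MemLp.const_mul ?_ _) _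
    have hm := h.1 m
    have hme : AEStronglyMeasurable (fun x => ψ m (c * x)) volume := by
      refine hm.1.comp_quasiMeasurePreserving ⟨by fun_prop, ?_⟩
      rw [Real.map_volume_mul_left hc.ne']
      exact Measure.smul_absolutelyContinuous
    rw [memLp_two_iff_integrable_sq hme]
    exact ((memLp_two_iff_integrable_sq hm.1).mp hm).comp_mul_left' hc.ne'
  · have e : ∀ x, dilatedSystem ε c ψ m x * dilatedSystem ε c ψ n x
        = (ε m * ε n * c) * (fun y => ψ m y * ψ n y) (c * x) := fun x => by
      simp only [dilatedSystem]
      linear_combination (ε m * ε n * ψ m (c * x) * ψ n (c * x)) * Real.mul_self_sqrt hc.le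
    simp only [e]
    rw [integral_const_mul, Measure.integral_comp_mul_left (fun y => ψ m y * ψ n y), h.2,
      abs_of_pos (inv_pos.mpr hc)]
    split_ifs with hmn
    · subst hmn
      rw [sq_eq_one_of_sign (hε m), smul_eq_mul]
      field_simp
    · simp

theorem isDifferentiationMatrix_dilatedSystem {ψ : ℕ → ℝ → ℝ} {D : Matrix ℕ ℕ ℝ}
    (h : IsDifferentiationMatrix ψ D) (c : ℝ) {ε : ℕ → ℝ} (hε : ∀ m, ε m = 1 ∨ ε m = -1) :
    IsDifferentiationMatrix (dilatedSystem ε c ψ) fun m k => c * ε m * ε k * D m k := by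
  intro m
  have hd : ∀ x, HasDerivAt (dilatedSystem ε c ψ m)
      (ε m * √c * c * deriv (ψ m) (c * x)) x := fun x => by
    have h1 := ((h m).1 (c * x)).hasDerivAt.comp x ((hasDerivAt_id x).const_mul c)
    exact ((h1.const_mul √c).const_mul (ε m)).congr_deriv (by ring)
  refine ⟨fun x => (hd x).differentiableAt, fun x => ?_⟩
  rw [(hd x).deriv]
  refine (((h m).2 (c * x)).mul_left (ε m * √c * c)).congr_fun fun k => ?_
  simp only [dilatedSystem]
  linear_combination (c * ε m * D m k * √c * ψ k (c * x)) * sq_eq_one_of_sign (hε k)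

theorem Real.hasDerivAt_artanh {t : ℝ} (ht : t ∈ Ioo (-1 : ℝ) 1) :
    HasDerivAt Real.artanh (1 - t ^ 2)⁻¹ t := by
  have hnhds : Ioo (-1 : ℝ) 1 ∈ nhds t := isOpen_Ioo.mem_nhds ht
  have h := Real.hasDerivAt_tanh (Real.artanh t)
  rw [Real.tanh_artanh ht] at h
  refine HasDerivAt.of_local_left_inverse ?_ h (by nlinarith [ht.1, ht.2])
    (Filter.mem_of_superset hnhds fun y hy => Real.tanh_artanh hy)
  exact Real.strictMonoOn_artanh.continuousAt_of_image_mem_nhds hnhds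
    (by rw [Real.artanh_bijOn.image_eq]; exact Filter.univ_mem)

theorem isOrthonormalPolySystem_jacobi {α β : ℝ} (hα : -1 < α) (hβ : -1 < β) {a : ℕ → ℝ} {b : ℝ}
    (hb : 0 < b) (ha : ∀ m, a m * a m = b) :
    IsOrthonormalPolySystem (fun t => b⁻¹ * jacobiWeight α β t)
      (fun m => C (a m) * jacobiOrthonormal α β m) where
  weight_nonneg t ht := mul_nonneg (inv_nonneg.mpr hb.le) (jacobiWeight_pos α β ht).le
  weight_integrable := (integrableOn_jacobiWeight hα hβ).const_mul _
  degree_eq m := by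
    have : a m ≠ 0 := fun h => by have := ha m; rw [h] at this; linarith
    rw [degree_C_mul this, degree_jacobiOrthonormal hα hβ]
  orthonormal m n := by
    have e : ∀ t, (C (a m) * jacobiOrthonormal α β m).eval t
        * (C (a n) * jacobiOrthonormal α β n).eval t * (b⁻¹ * jacobiWeight α β t)
        = (a m * a n * b⁻¹) * ((jacobiOrthonormal α β m * jacobiOrthonormal α β n).eval t
          * jacobiWeight α β t) := fun t => by
      simp only [eval_mul, eval_C]; ring
    simp only [e]
    rw [integral_const_mul, ← jacobiFunctional_apply hα hβ, jacobiFunctional_jacobiOrthonormal]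
    split_ifs with h
    · subst h
      rw [ha, mul_inv_cancel₀ hb.ne', one_mul]
    · simp

/-- The model of the family: `H = 2 tanh²(cx) - 1`, with inverse `h(t) = artanh √((1+t)/2) / c`. -/
theorem isHalfRangeSystem_dilatedSystem {α : ℝ} (hα : -1 < α) {c : ℝ} (hc : 0 < c) {ε : ℕ → ℝ}
    (hε : ∀ m, ε m = 1 ∨ ε m = -1) :
    IsHalfRangeSystem (dilatedSystem ε c (halfRangeJacobi α)) := by
  have hτ : ∀ t ∈ Ioo (-1 : ℝ) 1, √((1 + t) / 2) ∈ Ioo (0 : ℝ) 1 := fun t ht =>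
    ⟨Real.sqrt_pos.mpr (by linarith [ht.1]), by
      rw [Real.sqrt_lt' one_pos]; linarith [ht.2]⟩
  have hτ' : ∀ t ∈ Ioo (-1 : ℝ) 1, √((1 + t) / 2) ∈ Ioo (-1 : ℝ) 1 := fun t ht =>
    ⟨by linarith [(hτ t ht).1], (hτ t ht).2⟩
  have hd : ∀ t ∈ Ioo (-1 : ℝ) 1, HasDerivAt (fun t => c⁻¹ * Real.artanh √((1 + t) / 2))
      (c⁻¹ * ((1 - √((1 + t) / 2) ^ 2)⁻¹ * (1 / 2 / (2 * √((1 + t) / 2))))) t := fun t ht => by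
    have h1 := (((hasDerivAt_id t).const_add 1).div_const 2).sqrt
      (by simp only [id]; linarith [ht.1])
    exact ((Real.hasDerivAt_artanh (hτ' t ht)).comp t h1).const_mul c⁻¹
  have sq2 : ∀ γ : ℝ, ((2 : ℝ) ^ (γ / 2)) * 2 ^ (γ / 2) = 2 ^ γ := fun γ => by
    rw [← Real.rpow_add two_pos]; congr 1; ring
  refine ⟨fun t => c⁻¹ * Real.artanh √((1 + t) / 2), fun x => 2 * Real.tanh (c * x) ^ 2 - 1,
    fun x => Real.cosh (c * x) ^ (-(α + 1)),
    fun x => Real.cosh (c * x) ^ (-(α + 1)) * Real.tanh (c * x), _, _, _, _,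
    { h_differentiable := fun t ht => (hd t ht).differentiableAt
      h_deriv_pos := ?_
      h_onto := ?_
      H_inverse := ?_
      H_even := fun x => by simp
      ΘE_even := fun x => by simp
      ΘO_odd := fun x => by simp
      ΘE_zero := by simp
      r_orthonormal := isOrthonormalPolySystem_jacobi (α := α) (β := -1 / 2) hα (by norm_num)
        (a := fun m => ε (2 * m) * √c * 2 ^ ((2 * α + 1) / 2 / 2))
        (b := c * 2 ^ ((2 * α + 1) / 2)) (by positivity) ?_
      s_orthonormal := isOrthonormalPolySystem_jacobi (α := α) (β := 1 / 2) hα (by norm_num)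
        (a := fun m => -(ε (2 * m + 1) * √c * 2 ^ ((2 * α + 3) / 2 / 2)))
        (b := c * 2 ^ ((2 * α + 3) / 2)) (by positivity) ?_
      even_eq := ?_
      odd_eq := ?_ }⟩
  · intro t ht
    rw [(hd t ht).deriv]
    have h1 := hτ t ht
    have h2 : 0 < 1 - √((1 + t) / 2) ^ 2 := by nlinarith [h1.1, h1.2]
    have h3 := h1.1
    positivity
  · ext x
    constructor
    · rintro ⟨t, ht, rfl⟩
      exact mul_pos (inv_pos.mpr hc) (Real.artanh_pos (hτ t ht))
    · intro hx
      have hx' : 0 < c * x := mul_pos hc hx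
      have h1 : 0 < Real.tanh (c * x) := by
        rw [Real.tanh_eq_sinh_div_cosh]
        exact div_pos (Real.sinh_pos_iff.mpr hx') (Real.cosh_pos _)
      have h2 := Real.tanh_lt_one (c * x)
      refine ⟨2 * Real.tanh (c * x) ^ 2 - 1, ⟨by nlinarith, by nlinarith⟩, ?_⟩
      simp only
      rw [show (1 + (2 * Real.tanh (c * x) ^ 2 - 1)) / 2 = Real.tanh (c * x) ^ 2 by ring,
        Real.sqrt_sq h1.le, Real.artanh_tanh]
      field_simp
  · intro t ht
    rw [mul_inv_cancel_left₀ hc.ne', Real.tanh_artanh (hτ' t ht),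
      Real.sq_sqrt (by linarith [ht.1])]
    ring
  · intro m
    linear_combination (√c * √c * (2 ^ ((2 * α + 1) / 2 / 2) * 2 ^ ((2 * α + 1) / 2 / 2)))
      * sq_eq_one_of_sign (hε (2 * m)) + (2 ^ ((2 * α + 1) / 2 / 2) * 2 ^ ((2 * α + 1) / 2 / 2))
        * Real.mul_self_sqrt hc.le + c * sq2 ((2 * α + 1) / 2)
  · intro m
    linear_combination (√c * √c * (2 ^ ((2 * α + 3) / 2 / 2) * 2 ^ ((2 * α + 3) / 2 / 2)))
      * sq_eq_one_of_sign (hε (2 * m + 1)) + (2 ^ ((2 * α + 3) / 2 / 2)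
        * 2 ^ ((2 * α + 3) / 2 / 2)) * Real.mul_self_sqrt hc.le + c * sq2 ((2 * α + 3) / 2)
  · intro m x
    rw [dilatedSystem, halfRangeJacobi_two_mul, halfRangeEven_eq, eval_mul, eval_C,
      show (2 * α + 1) / 2 / 2 = (2 * α + 1) / 4 by ring]
    ring
  · intro m x
    rw [dilatedSystem, halfRangeJacobi_two_mul_add_one, halfRangeOdd_eq, eval_mul, eval_C,
      show (2 * α + 3) / 2 / 2 = (2 * α + 3) / 4 by ring]
    ring

/-! ### Consequences of orthonormality for the differentiation matrix -/

theorem IsOrthonormalSystem.coeff_eq_integral {φ : ℕ → ℝ → ℝ} (h : IsOrthonormalSystem φ)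
    {f : ℝ → ℝ} {N : ℕ} {a : ℕ → ℝ} (hf : ∀ x, f x = ∑ k ∈ Finset.range N, a k * φ k x) {j : ℕ}
    (hj : j < N) : a j = ∫ x, f x * φ j x := by
  simp only [hf, Finset.sum_mul, mul_assoc]
  rw [integral_finsetSum]
  · simp only [integral_const_mul, h.2]
    simp [hj]
  · intro k _
    exact ((h.1 k).integrable_mul (h.1 j)).const_mul _

theorem IsDifferentiationMatrix.deriv_eq_sum {φ : ℕ → ℝ → ℝ} {D : Matrix ℕ ℕ ℝ}
    (hD : IsDifferentiationMatrix φ D) (ht : IsTridiagonal D) (m : ℕ) (x : ℝ) :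
    deriv (φ m) x = ∑ k ∈ Finset.range (m + 2), D m k * φ k x := by
  refine ((hD m).2 x).unique (hasSum_sum_of_ne_finset_zero fun k hk => ?_)
  rw [ht m k (Or.inl (by simp at hk; omega)), zero_mul]

/-- For an orthonormal system the entries of a tridiagonal differentiation matrix are the integrals
`∫ φ_m' φ_k`, so they do not depend on the matrix. -/
theorem superdiagonal_unique {φ : ℕ → ℝ → ℝ} (h : IsOrthonormalSystem φ) {D D' : Matrix ℕ ℕ ℝ}
    (hD : IsDifferentiationMatrix φ D) (ht : IsTridiagonal D)
    (hD' : IsDifferentiationMatrix φ D') (ht' : IsTridiagonal D') (m : ℕ) :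
    D m (m + 1) = D' m (m + 1) := by
  rw [h.coeff_eq_integral (hD.deriv_eq_sum ht m) (j := m + 1) (by omega),
    h.coeff_eq_integral (hD'.deriv_eq_sum ht' m) (j := m + 1) (by omega)]

/-! ### The profile equation -/

theorem eq_zero_of_tendsto_of_tendsto_deriv {f f' : ℝ → ℝ} {L M : ℝ}
    (hd : ∀ x, 0 < x → HasDerivAt f (f' x) x) (hf : Tendsto f atTop (𝓝 L))
    (hf' : Tendsto f' atTop (𝓝 M)) : M = 0 := by
  have hξ : ∀ x, ∃ ξ, x < ξ ∧ (0 < x → f' ξ = f (x + 1) - f x) := fun x => by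
    by_cases hx : 0 < x
    · obtain ⟨ξ, hξ, h⟩ := exists_hasDerivAt_eq_slope f f' (lt_add_one x)
        (fun y hy => (hd y (hx.trans_le hy.1)).continuousAt.continuousWithinAt)
        (fun y hy => hd y (hx.trans hy.1))
      exact ⟨ξ, hξ.1, fun _ => by rw [h]; simp⟩
    · exact ⟨x + 1, lt_add_one x, fun h => absurd h hx⟩
  choose ξ hξ1 hξ2 using hξ
  have h1 : Tendsto (fun x => f' (ξ x)) atTop (𝓝 M) :=
    hf'.comp (tendsto_atTop_mono (fun x => (hξ1 x).le) tendsto_id)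
  have h2 : Tendsto (fun x => f (x + 1) - f x) atTop (𝓝 (L - L)) :=
    (hf.comp (tendsto_atTop_add_const_right atTop 1 tendsto_id)).sub hf
  rw [sub_self] at h2
  refine tendsto_nhds_unique h1 (h2.congr' ?_)
  filter_upwards [eventually_gt_atTop 0] with x hx using (hξ2 x hx).symm

/-- If `H' > 0`, `H'² = P(H)` and `H` tends to `1` at infinity, then `1` is a double zero of `P`:
otherwise `H` would reach `1` in finite time. -/
theorem double_root_of_profile {H H' P P' : ℝ → ℝ} (hP : ∀ y, HasDerivAt P (P' y) y)
    (hP' : Continuous P') (hH : ∀ x, 0 < x → HasDerivAt H (H' x) x) (hpos : ∀ x, 0 < x → 0 < H' x)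
    (hlim : Tendsto H atTop (𝓝 1)) (hode : ∀ x, 0 < x → H' x ^ 2 = P (H x)) :
    P 1 = 0 ∧ P' 1 = 0 := by
  have hP1 : Tendsto (fun x => P (H x)) atTop (𝓝 (P 1)) :=
    ((hP 1).continuousAt.tendsto).comp hlim
  have hsqrt : Tendsto (fun x => √(P (H x))) atTop (𝓝 √(P 1)) := hP1.sqrt
  have hH' : ∀ x, 0 < x → √(P (H x)) = H' x := fun x hx => by
    rw [← hode x hx, Real.sqrt_sq (hpos x hx).le]
  constructor
  · have h0 : √(P 1) = 0 := eq_zero_of_tendsto_of_tendsto_deriv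
      (fun x hx => by rw [hH' x hx]; exact hH x hx) hlim hsqrt
    refine le_antisymm (Real.sqrt_eq_zero'.mp h0) (ge_of_tendsto hP1 ?_)
    filter_upwards [eventually_gt_atTop 0] with x hx
    rw [← hode x hx]
    positivity
  · have h0 : P' 1 / 2 = 0 := by
      refine eq_zero_of_tendsto_of_tendsto_deriv (f' := fun x => P' (H x) / 2) (fun x hx => ?_)
        hsqrt (((hP'.tendsto 1).comp hlim).div_const 2)
      have h1 := hpos x hx
      have h2 : P (H x) ≠ 0 := by rw [← hode x hx]; positivity
      refine (((hP (H x)).comp x (hH x hx)).sqrt h2).congr_deriv ?_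
      simp only [Function.comp_apply]
      rw [hH' x hx]
      field_simp
    linarith

/-- The only admissible factorization of the cubic in the profile equation. -/
theorem profile_factors {A0 A1 q0 q1 q2 : ℝ} (hQ : q0 - q1 + q2 = 0)
    (hA : ¬ (A0 = 0 ∧ A1 = 0)) (hq : ¬ (q0 = 0 ∧ q1 = 0 ∧ q2 = 0))
    (h1 : (A0 + A1) * (q0 + q1 + q2) = 0)
    (h2 : A1 * (q0 + q1 + q2) + (A0 + A1) * (q1 + 2 * q2) = 0) :
    A0 = -A1 ∧ q1 = 0 ∧ q0 = -q2 := by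
  rcases mul_eq_zero.mp h1 with h | h
  · have hA1 : A1 ≠ 0 := fun h3 => hA ⟨by rw [h3] at h; linarith, h3⟩
    rw [h, zero_mul, add_zero] at h2
    have := (mul_eq_zero.mp h2).resolve_left hA1
    exact ⟨by linarith, by linarith, by linarith⟩
  · rw [h, mul_zero, zero_add] at h2
    rcases mul_eq_zero.mp h2 with h3 | h3
    · exact ⟨by linarith, by linarith, by linarith⟩
    · exact absurd ⟨by linarith, by linarith, by linarith⟩ hq

/-- With `τ = √((1 + H) / 2)` the profile equation reads `τ' = c (1 - τ²)`, so `artanh τ - c x` is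
constant. -/
theorem profile_eq_tanh {H H' : ℝ → ℝ} {κ : ℝ} (hH : ∀ x, 0 < x → HasDerivAt H (H' x) x)
    (hpos : ∀ x, 0 < x → 0 < H' x) (hmem : ∀ x, 0 < x → H x ∈ Ioo (-1 : ℝ) 1)
    (h0 : H 0 = -1) (hc0 : ContinuousAt H 0)
    (hode : ∀ x, 0 < x → H' x ^ 2 = κ * ((1 - H x) ^ 2 * (1 + H x))) :
    ∃ c, 0 < c ∧ κ = 2 * c ^ 2 ∧ ∀ x, 0 ≤ x → H x = 2 * Real.tanh (c * x) ^ 2 - 1 := by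
  have hκ : 0 < κ := by
    have h1 := hode 1 one_pos
    have h2 := hmem 1 one_pos
    have h3 : 0 < (1 - H 1) ^ 2 * (1 + H 1) :=
      mul_pos (pow_pos (by linarith [h2.2]) 2) (by linarith [h2.1])
    have h4 := pow_pos (hpos 1 one_pos) 2
    rw [h1] at h4
    exact (mul_pos_iff_of_pos_right h3).mp h4
  set c := √(κ / 2) with hc
  have hcpos : 0 < c := Real.sqrt_pos.mpr (by linarith)
  have hc2 : κ = 2 * c ^ 2 := by rw [hc, Real.sq_sqrt (by linarith)]; ring
  refine ⟨c, hcpos, hc2, fun x hx => ?_⟩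
  set τ : ℝ → ℝ := fun x => √((1 + H x) / 2) with hτ
  have hτsq : ∀ x, 0 < x → τ x ^ 2 = (1 + H x) / 2 := fun x hx =>
    Real.sq_sqrt (by linarith [(hmem x hx).1])
  have hτpos : ∀ x, 0 < x → 0 < τ x := fun x hx => Real.sqrt_pos.mpr (by linarith [(hmem x hx).1])
  have hτlt : ∀ x, 0 < x → τ x < 1 := fun x hx => by
    rw [hτ]; simp only; rw [Real.sqrt_lt' one_pos]; linarith [(hmem x hx).2]
  have hτ0 : τ 0 = 0 := by simp [hτ, h0]
  have hH'τ : ∀ x, 0 < x → H' x = 4 * c * ((1 - τ x ^ 2) * τ x) := fun x hx => by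
    have h1 : 0 ≤ 4 * c * ((1 - τ x ^ 2) * τ x) := by
      have := hτpos x hx
      have : 0 < 1 - τ x ^ 2 := by nlinarith [hτlt x hx]
      positivity
    have e : H x = 2 * τ x ^ 2 - 1 := by rw [hτsq x hx]; ring
    refine (pow_left_inj₀ (hpos x hx).le h1 two_ne_zero).mp ?_
    rw [hode x hx, hc2, e]
    ring
  have hd : ∀ x, 0 < x → HasDerivAt (fun x => Real.artanh (τ x) - c * x) 0 x := fun x hx => by
    have h1 := (((hH x hx).const_add 1).div_const 2).sqrt (by linarith [(hmem x hx).1])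
    have h2 := (Real.hasDerivAt_artanh ⟨by linarith [hτpos x hx], hτlt x hx⟩).comp x h1
    refine (h2.sub ((hasDerivAt_id x).const_mul c)).congr_deriv ?_
    have h3 := (hτpos x hx).ne'
    have h4 : 1 - τ x ^ 2 ≠ 0 := by nlinarith [hτlt x hx, hτpos x hx]
    change (1 - τ x ^ 2)⁻¹ * (H' x / 2 / (2 * τ x)) - c * 1 = 0
    rw [hH'τ x hx]
    field_simp
    ring
  rcases hx.eq_or_lt with rfl | hx
  · simp [h0]
  have hcont : ContinuousOn (fun x => Real.artanh (τ x) - c * x) (Icc 0 x) := by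
    intro y hy
    rcases hy.1.eq_or_lt with rfl | hy0
    · refine ContinuousAt.continuousWithinAt (ContinuousAt.sub ?_ (by fun_prop))
      refine ContinuousAt.comp (g := Real.artanh) ?_ ((hc0.const_add 1).div_const 2).sqrt
      exact (Real.hasDerivAt_artanh (by rw [hτ0]; norm_num)).continuousAt
    · exact (hd y hy0).continuousAt.continuousWithinAt
  obtain ⟨ξ, -, h⟩ := exists_hasDerivAt_eq_slope _ (fun _ => 0) hx hcont (fun y hy => hd y hy.1)
  have h1 : Real.artanh (τ x) = c * x := by
    rw [eq_comm, div_eq_zero_iff] at h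
    rcases h with h | h
    · rw [hτ0, Real.artanh_zero] at h; linarith
    · linarith
  rw [← h1, Real.tanh_artanh ⟨by linarith [hτpos x hx], hτlt x hx⟩, hτsq x hx]
  ring

/-- A solution of `u' = k v`, `v' = u g` with bounded `g` cannot vanish at one point only. -/
theorem eq_zero_of_linear_system {u v g : ℝ → ℝ} {k M : ℝ} (hu : ∀ x, HasDerivAt u (k * v x) x)
    (hv : ∀ x, HasDerivAt v (u x * g x) x) (hg : ∀ x, |g x| ≤ M) {x : ℝ} (hx : 0 ≤ x)
    (hux : u x = 0) (hvx : v x = 0) : u 0 = 0 := by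
  have hd : ∀ y, HasDerivAt (fun y => Real.exp ((|k| + M) * y) * (u y ^ 2 + v y ^ 2))
      (Real.exp ((|k| + M) * y) * ((|k| + M) * (u y ^ 2 + v y ^ 2)
        + 2 * (k + g y) * (u y * v y))) y := fun y => by
    refine ((((hasDerivAt_id y).const_mul (|k| + M)).exp).mul
      (((hu y).pow 2).add ((hv y).pow 2))).congr_deriv ?_
    simp only [id, Pi.add_apply, Pi.pow_apply]
    ring
  have hmono : Monotone fun y => Real.exp ((|k| + M) * y) * (u y ^ 2 + v y ^ 2) := by
    refine monotone_of_hasDerivAt_nonneg hd fun y => mul_nonneg (Real.exp_pos _).le ?_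
    have h1 : |k + g y| ≤ |k| + M := (abs_add_le _ _).trans (by linarith [hg y])
    have h2 : |2 * (u y * v y)| ≤ u y ^ 2 + v y ^ 2 := by
      rw [abs_le]; constructor <;> nlinarith [sq_nonneg (u y + v y), sq_nonneg (u y - v y)]
    have h3 : |2 * (k + g y) * (u y * v y)| ≤ (|k| + M) * (u y ^ 2 + v y ^ 2) := by
      rw [show 2 * (k + g y) * (u y * v y) = (k + g y) * (2 * (u y * v y)) by ring, abs_mul]
      exact mul_le_mul h1 h2 (abs_nonneg _) ((abs_nonneg _).trans h1)
    linarith [neg_abs_le (2 * (k + g y) * (u y * v y))]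
  have h := hmono hx
  simp only [mul_zero, Real.exp_zero, hux, hvx] at h
  nlinarith [sq_nonneg (u 0), sq_nonneg (v 0)]

/-! ### The functions of a half-range model with tridiagonal differentiation matrix -/

theorem IsSkewSymmetric.swap {D : Matrix ℕ ℕ ℝ} (h : IsSkewSymmetric D) (m k : ℕ) :
    D k m = -D m k := congrFun (congrFun h m) k

theorem hasDerivAt_zero_of_skew {φ : ℕ → ℝ → ℝ} {D : Matrix ℕ ℕ ℝ} (hD : IsDifferentiationMatrix φ D)
    (ht : IsTridiagonal D) (hs : IsSkewSymmetric D) (x : ℝ) :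
    HasDerivAt (φ 0) (D 0 1 * φ 1 x) x := by
  refine ((hD 0).1 x).hasDerivAt.congr_deriv ?_
  have h0 : D 0 0 = 0 := by linarith [hs.swap 0 0]
  rw [hD.deriv_eq_sum ht]
  simp [Finset.sum_range_succ, h0]

/-- The three-term form of the derivatives; the diagonal of a skew-symmetric matrix is zero. -/
theorem hasDerivAt_succ_of_skew {φ : ℕ → ℝ → ℝ} {D : Matrix ℕ ℕ ℝ} (hD : IsDifferentiationMatrix φ D)
    (ht : IsTridiagonal D) (hs : IsSkewSymmetric D) (m : ℕ) (x : ℝ) :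
    HasDerivAt (φ (m + 1)) (-D m (m + 1) * φ m x + D (m + 1) (m + 2) * φ (m + 2) x) x := by
  refine ((hD (m + 1)).1 x).hasDerivAt.congr_deriv ?_
  have h0 : D (m + 1) (m + 1) = 0 := by linarith [hs.swap (m + 1) (m + 1)]
  rw [hD.deriv_eq_sum ht, Finset.sum_range_succ, Finset.sum_range_succ, Finset.sum_range_succ,
    Finset.sum_eq_zero, h0, hs.swap m (m + 1)]
  · ring
  · intro k hk
    rw [ht _ _ (Or.inr (by have := Finset.mem_range.mp hk; omega)), zero_mul]

theorem Polynomial.eval_of_degree_eq_zero {p : ℝ[X]} (h : p.degree = (0 : ℕ)) (y : ℝ) :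
    p.eval y = p.coeff 0 := by
  rw [eval_eq_sum_range, natDegree_eq_of_degree_eq_some h]; simp

theorem Polynomial.eval_of_degree_eq_one {p : ℝ[X]} (h : p.degree = (1 : ℕ)) (y : ℝ) :
    p.eval y = p.coeff 0 + p.coeff 1 * y := by
  rw [eval_eq_sum_range, natDegree_eq_of_degree_eq_some h]; simp [Finset.sum_range_succ]

theorem Polynomial.eval_of_degree_eq_two {p : ℝ[X]} (h : p.degree = (2 : ℕ)) (y : ℝ) :
    p.eval y = p.coeff 0 + p.coeff 1 * y + p.coeff 2 * y ^ 2 := by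
  rw [eval_eq_sum_range, natDegree_eq_of_degree_eq_some h]; simp [Finset.sum_range_succ]

section Model

variable {φ : ℕ → ℝ → ℝ} {h H ΘE ΘO wE wO : ℝ → ℝ} {r s : ℕ → ℝ[X]}

/-- The differential relations for `φ_0, …, φ_3`, written in terms of `Θ_E`, `Θ_O` and `H`. -/
theorem IsHalfRangeModel.relations (M : IsHalfRangeModel φ h H ΘE ΘO wE wO r s)
    {D : Matrix ℕ ℕ ℝ} (hD : IsDifferentiationMatrix φ D) (ht : IsTridiagonal D)
    (hs : IsSkewSymmetric D) :
    ∃ k l0 l1 A0 A1 q0 q1 q2 : ℝ,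
      (∀ x, HasDerivAt ΘE (k * ΘO x) x) ∧ (∀ x, HasDerivAt ΘO (ΘE x * (l0 + l1 * H x)) x) ∧
      ∀ x H', HasDerivAt H H' x → ΘE x * H' = ΘO x * (A0 + A1 * H x) ∧
        ΘO x * H' = ΘE x * (q0 + q1 * H x + q2 * H x ^ 2) := by
  have er0 := eval_of_degree_eq_zero (M.r_orthonormal.degree_eq 0)
  have er1 := eval_of_degree_eq_one (M.r_orthonormal.degree_eq 1)
  have er2 := eval_of_degree_eq_two (M.r_orthonormal.degree_eq 2)
  have es0 := eval_of_degree_eq_zero (M.s_orthonormal.degree_eq 0)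
  have es1 := eval_of_degree_eq_one (M.s_orthonormal.degree_eq 1)
  have nr0 : (r 0).coeff 0 ≠ 0 := coeff_ne_zero_of_eq_degree (M.r_orthonormal.degree_eq 0)
  have nr1 : (r 1).coeff 1 ≠ 0 := coeff_ne_zero_of_eq_degree (M.r_orthonormal.degree_eq 1)
  have ns0 : (s 0).coeff 0 ≠ 0 := coeff_ne_zero_of_eq_degree (M.s_orthonormal.degree_eq 0)
  have ns1 : (s 1).coeff 1 ≠ 0 := coeff_ne_zero_of_eq_degree (M.s_orthonormal.degree_eq 1)
  have f0 : ∀ x, φ 0 x = ΘE x * (r 0).coeff 0 := fun x => by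
    have := M.even_eq 0 x; rwa [er0] at this
  have f1 : ∀ x, φ 1 x = ΘO x * (s 0).coeff 0 := fun x => by
    have := M.odd_eq 0 x; rwa [es0] at this
  have f2 : ∀ x, φ 2 x = ΘE x * ((r 1).coeff 0 + (r 1).coeff 1 * H x) := fun x => by
    have := M.even_eq 1 x; rwa [er1] at this
  have f3 : ∀ x, φ 3 x = ΘO x * ((s 1).coeff 0 + (s 1).coeff 1 * H x) := fun x => by
    have := M.odd_eq 1 x; rwa [es1] at this
  have f4 : ∀ x, φ 4 x = ΘE x * ((r 2).coeff 0 + (r 2).coeff 1 * H x + (r 2).coeff 2 * H x ^ 2) :=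
    fun x => by have := M.even_eq 2 x; rwa [er2] at this
  have d0 := hasDerivAt_zero_of_skew hD ht hs
  have d1 := hasDerivAt_succ_of_skew hD ht hs 0
  have d2 := hasDerivAt_succ_of_skew hD ht hs 1
  have d3 := hasDerivAt_succ_of_skew hD ht hs 2
  simp only [zero_add, Nat.reduceAdd, f0, f1, f2, f3, f4] at d0 d1 d2 d3
  rw [funext f0] at d0
  rw [funext f1] at d1
  rw [funext f2] at d2
  rw [funext f3] at d3
  generalize (r 0).coeff 0 = r00 at *
  generalize (r 1).coeff 0 = r10 at *
  generalize (r 1).coeff 1 = r11 at *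
  generalize (r 2).coeff 0 = r20 at *
  generalize (r 2).coeff 1 = r21 at *
  generalize (r 2).coeff 2 = r22 at *
  generalize (s 0).coeff 0 = s00 at *
  generalize (s 1).coeff 0 = s10 at *
  generalize (s 1).coeff 1 = s11 at *
  generalize D 0 1 = b0 at *
  generalize D 1 2 = b1 at *
  generalize D 2 3 = b2 at *
  generalize D 3 4 = b3 at *
  have hE : ∀ x, HasDerivAt ΘE (b0 * s00 / r00 * ΘO x) x := fun x => by
    have := (d0 x).mul_const r00⁻¹
    simp only [mul_inv_cancel_right₀ nr0] at this
    exact this.congr_deriv (by field_simp)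
  have hO : ∀ x, HasDerivAt ΘO
      (ΘE x * ((-b0 * r00 + b1 * r10) / s00 + b1 * r11 / s00 * H x)) x := fun x => by
    have := (d1 x).mul_const s00⁻¹
    simp only [mul_inv_cancel_right₀ ns0] at this
    exact this.congr_deriv (by field_simp; ring)
  refine ⟨b0 * s00 / r00, (-b0 * r00 + b1 * r10) / s00, b1 * r11 / s00,
    (-b1 * s00 + b2 * s10 - b0 * s00 / r00 * r10) / r11, (b2 * s11 - b0 * s00 / r00 * r11) / r11,
    (-b2 * r10 + b3 * r20 - (-b0 * r00 + b1 * r10) / s00 * s10) / s11,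
    (-b2 * r11 + b3 * r21 - (-b0 * r00 + b1 * r10) / s00 * s11 - b1 * r11 / s00 * s10) / s11,
    (b3 * r22 - b1 * r11 / s00 * s11) / s11, hE, hO, fun x H' hH => ⟨?_, ?_⟩⟩
  · have e := ((hE x).mul ((hH.const_mul r11).const_add r10)).unique (d2 x)
    field_simp at e ⊢
    linear_combination e
  · have e := ((hO x).mul ((hH.const_mul s11).const_add s10)).unique (d3 x)
    field_simp at e ⊢
    linear_combination e

/-- The model says nothing about `H` at the origin; there `H` is an
affine function of `φ_2 / Θ_E`. -/
theorem IsHalfRangeModel.differentiableAt_zero (M : IsHalfRangeModel φ h H ΘE ΘO wE wO r s)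
    (hφ : DifferentiableAt ℝ (φ 2) 0) (hE : DifferentiableAt ℝ ΘE 0) : DifferentiableAt ℝ H 0 := by
  have er1 := eval_of_degree_eq_one (M.r_orthonormal.degree_eq 1)
  have nr1 : (r 1).coeff 1 ≠ 0 := coeff_ne_zero_of_eq_degree (M.r_orthonormal.degree_eq 1)
  have h1 : DifferentiableAt ℝ (fun x => (φ 2 x / ΘE x - (r 1).coeff 0) / (r 1).coeff 1) 0 :=
    ((hφ.div hE M.ΘE_zero).sub_const _).div_const _
  refine h1.congr_of_eventuallyEq ?_
  filter_upwards [hE.continuousAt.eventually_ne M.ΘE_zero] with x hx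
  have := M.even_eq 1 x
  rw [er1, mul_one] at this
  rw [this]
  field_simp
  ring

theorem IsHalfRangeModel.strictMonoOn (M : IsHalfRangeModel φ h H ΘE ΘO wE wO r s) :
    StrictMonoOn h (Ioo (-1) 1) := by
  refine strictMonoOn_of_deriv_pos (convex_Ioo _ _)
    (fun t ht => (M.h_differentiable t ht).continuousAt.continuousWithinAt) fun t ht => ?_
  rw [interior_Ioo] at ht
  exact M.h_deriv_pos t ht

theorem IsHalfRangeModel.mem_Ioo (M : IsHalfRangeModel φ h H ΘE ΘO wE wO r s) {x : ℝ} (hx : 0 < x) :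
    H x ∈ Ioo (-1 : ℝ) 1 ∧ h (H x) = x := by
  obtain ⟨t, ht, rfl⟩ : x ∈ h '' Ioo (-1) 1 := by rw [M.h_onto]; exact hx
  rw [M.H_inverse t ht]
  exact ⟨ht, rfl⟩

/-- `H` and `h` are inverse increasing functions. -/
theorem IsHalfRangeModel.lt_iff (M : IsHalfRangeModel φ h H ΘE ΘO wE wO r s) {x t : ℝ} (hx : 0 < x)
    (ht : t ∈ Ioo (-1 : ℝ) 1) : H x < t ↔ x < h t := by
  obtain ⟨h1, h2⟩ := M.mem_Ioo hx
  conv_rhs => rw [← h2]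
  exact (M.strictMonoOn.lt_iff_lt h1 ht).symm

theorem IsHalfRangeModel.h_pos (M : IsHalfRangeModel φ h H ΘE ΘO wE wO r s) {t : ℝ}
    (ht : t ∈ Ioo (-1 : ℝ) 1) : 0 < h t := by
  have : h t ∈ h '' Ioo (-1) 1 := ⟨t, ht, rfl⟩
  rwa [M.h_onto] at this

theorem IsHalfRangeModel.hasDerivAt (M : IsHalfRangeModel φ h H ΘE ΘO wE wO r s) {x : ℝ}
    (hx : 0 < x) : HasDerivAt H (deriv h (H x))⁻¹ x := by
  have hnhds : Ioi (0 : ℝ) ∈ 𝓝 x := Ioi_mem_nhds hx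
  obtain ⟨h1, h2⟩ := M.mem_Ioo hx
  refine HasDerivAt.of_local_left_inverse ?_ (M.h_differentiable _ h1).hasDerivAt
    (M.h_deriv_pos _ h1).ne' (mem_of_superset hnhds fun y hy => (M.mem_Ioo hy).2)
  have hmono : StrictMonoOn H (Ioi 0) := fun a ha b hb hab => by
    rw [M.lt_iff ha (M.mem_Ioo hb).1, (M.mem_Ioo hb).2]
    exact hab
  refine hmono.continuousAt_of_image_mem_nhds hnhds (mem_of_superset (isOpen_Ioo.mem_nhds h1) ?_)
  exact fun t ht => ⟨h t, M.h_pos ht, M.H_inverse t ht⟩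

theorem IsHalfRangeModel.tendsto_atTop (M : IsHalfRangeModel φ h H ΘE ΘO wE wO r s) :
    Tendsto H atTop (𝓝 1) := by
  refine tendsto_order.mpr ⟨fun a ha => ?_, fun a ha => ?_⟩
  · have hm : max a 0 ∈ Ioo (-1 : ℝ) 1 := ⟨by linarith [le_max_right a 0], max_lt ha one_pos⟩
    filter_upwards [eventually_gt_atTop 0, eventually_gt_atTop (h (max a 0))] with x hx hx'
    by_contra hlt
    have h1 : H x ≤ max a 0 := (not_lt.mp hlt).trans (le_max_left _ _)
    rcases h1.lt_or_eq with h1 | h1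
    · exact absurd ((M.lt_iff hx hm).mp h1) hx'.le.not_gt
    · rw [← h1, (M.mem_Ioo hx).2] at hx'
      exact lt_irrefl _ hx'
  · filter_upwards [eventually_gt_atTop 0] with x hx
    exact (M.mem_Ioo hx).1.2.trans ha

theorem IsHalfRangeModel.map_zero (M : IsHalfRangeModel φ h H ΘE ΘO wE wO r s)
    (hc : ContinuousAt H 0) : H 0 = -1 := by
  have h1 : Tendsto H (𝓝[>] 0) (𝓝 (H 0)) := hc.tendsto.mono_left nhdsWithin_le_nhds
  refine tendsto_nhds_unique h1 (tendsto_order.mpr ⟨fun a ha => ?_, fun a ha => ?_⟩)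
  · filter_upwards [self_mem_nhdsWithin] with x hx
    exact ha.trans (M.mem_Ioo hx).1.1
  · have hm : min a 0 ∈ Ioo (-1 : ℝ) 1 :=
      ⟨lt_min ha (by norm_num), by linarith [min_le_right a 0]⟩
    filter_upwards [Ioo_mem_nhdsGT (M.h_pos hm)] with x hx
    exact ((M.lt_iff hx.1 hm).mpr hx.2).trans_le (min_le_left _ _)

/-- A half-range model with a skew-symmetric tridiagonal differentiation matrix has
`H = 2 tanh² - 1`, a power of `cosh` for `Θ_E` and a multiple of `tanh · Θ_E` for `Θ_O`, all at a
common dilated argument. -/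
theorem IsHalfRangeModel.exists_tanh_form (M : IsHalfRangeModel φ h H ΘE ΘO wE wO r s)
    {D : Matrix ℕ ℕ ℝ} (hD : IsDifferentiationMatrix φ D) (ht : IsTridiagonal D)
    (hs : IsSkewSymmetric D) :
    ∃ c δ σ : ℝ, 0 < c ∧ (∀ x, H x = 2 * Real.tanh (c * x) ^ 2 - 1) ∧
      (∀ x, ΘE x = ΘE 0 * Real.cosh (c * x) ^ (-δ)) ∧
      ∀ x, ΘO x = σ * Real.tanh (c * x) * ΘE x := by
  obtain ⟨k, l0, l1, A0, A1, q0, q1, q2, hE, hO, hrel⟩ := M.relations hD ht hs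
  have hd0 := M.differentiableAt_zero ((hD 2).1 0) (hE 0).differentiableAt
  have hH0 := M.map_zero hd0.continuousAt
  have hO0 : ΘO 0 = 0 := by have := M.ΘO_odd 0; rw [neg_zero] at this; linarith
  have hbound : ∀ x, |H x| ≤ 1 := by
    have key : ∀ x, 0 < x → |H x| ≤ 1 := fun x hx => by
      have := (M.mem_Ioo hx).1
      exact abs_le.mpr ⟨this.1.le, this.2.le⟩
    intro x
    rcases lt_trichotomy x 0 with hx | rfl | hx
    · rw [← M.H_even]; exact key _ (by linarith)
    · rw [hH0]; norm_num
    · exact key x hx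
  have hH : ∀ x, 0 < x → HasDerivAt H (deriv h (H x))⁻¹ x := fun x hx => M.hasDerivAt hx
  have hpos : ∀ x, 0 < x → 0 < (deriv h (H x))⁻¹ := fun x hx =>
    inv_pos.mpr (M.h_deriv_pos _ (M.mem_Ioo hx).1)
  have hne : ∀ x, 0 < x → ΘE x ≠ 0 := fun x hx h0 => by
    have h1 := (hrel x _ (hH x hx)).2
    rw [h0, zero_mul] at h1
    have h2 := (mul_eq_zero.mp h1).resolve_right (hpos x hx).ne'
    refine M.ΘE_zero (eq_zero_of_linear_system (g := fun x => l0 + l1 * H x) (M := |l0| + |l1|)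
      hE hO (fun y => ?_) hx.le h0 h2)
    refine (abs_add_le _ _).trans (add_le_add_right ?_ _)
    rw [abs_mul]
    exact mul_le_of_le_one_right (abs_nonneg _) (hbound y)
  have hneO : ∀ x, 0 < x → ΘO x ≠ 0 := fun x hx h0 => by
    have h1 := (hrel x _ (hH x hx)).1
    rw [h0, zero_mul] at h1
    exact (mul_ne_zero (hne x hx) (hpos x hx).ne') h1
  have hode : ∀ x, 0 < x → ((deriv h (H x))⁻¹) ^ 2
      = (A0 + A1 * H x) * (q0 + q1 * H x + q2 * H x ^ 2) := fun x hx => by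
    obtain ⟨e1, e2⟩ := hrel x _ (hH x hx)
    refine mul_left_cancel₀ (mul_ne_zero (hne x hx) (hneO x hx)) ?_
    linear_combination (ΘO x * (deriv h (H x))⁻¹) * e1 + ΘO x * (A0 + A1 * H x) * e2
  -- `Θ_O(0) = 0` and `H(0) = -1` give a zero of the quadratic
  have hQ : q0 - q1 + q2 = 0 := by
    have h1 := hd0.hasDerivAt
    have h2 := (hrel 0 _ h1).2
    rw [hO0, zero_mul, hH0, eq_comm] at h2
    have := (mul_eq_zero.mp h2).resolve_left M.ΘE_zero
    linarith
  obtain ⟨hP1, hP2⟩ := double_root_of_profile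
    (P := fun y => (A0 + A1 * y) * (q0 + q1 * y + q2 * y ^ 2))
    (P' := fun y => A1 * (q0 + q1 * y + q2 * y ^ 2) + (A0 + A1 * y) * (q1 + q2 * (2 * y)))
    (fun y => by
      have e1 := ((hasDerivAt_id y).const_mul A1).const_add A0
      have e2 := (((hasDerivAt_id y).const_mul q1).const_add q0).add
        ((hasDerivAt_pow 2 y).const_mul q2)
      refine (e1.mul e2).congr_deriv ?_
      simp) (by fun_prop) hH hpos M.tendsto_atTop hode
  obtain ⟨rfl, rfl, rfl⟩ := profile_factors (A0 := A0) (A1 := A1) hQ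
    (fun h0 => by
      have := hode 1 one_pos
      rw [h0.1, h0.2] at this
      have := pow_pos (hpos 1 one_pos) 2
      linarith)
    (fun h0 => by
      have := hode 1 one_pos
      rw [h0.1, h0.2.1, h0.2.2] at this
      have := pow_pos (hpos 1 one_pos) 2
      linarith) (by linarith) (by linarith)
  obtain ⟨c, hc, hκ, htanh⟩ := profile_eq_tanh (κ := A1 * q2) hH hpos
    (fun x hx => (M.mem_Ioo hx).1) hH0 hd0.continuousAt (fun x hx => by rw [hode x hx]; ring)
  have hA1 : A1 ≠ 0 := fun h0 => by
    rw [h0, zero_mul] at hκ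
    nlinarith [pow_pos hc 2]
  have hHt : ∀ x, H x = 2 * Real.tanh (c * x) ^ 2 - 1 := fun x => by
    rcases le_total 0 x with hx | hx
    · exact htanh x hx
    · rw [← M.H_even, htanh (-x) (by linarith)]
      simp
  have hHd : ∀ x, HasDerivAt H
      (4 * c * (Real.tanh (c * x) * (1 - Real.tanh (c * x) ^ 2))) x := fun x => by
    rw [funext hHt]
    refine ((((Real.hasDerivAt_tanh (c * x)).comp x ((hasDerivAt_id x).const_mul c)).pow
      2).const_mul 2 |>.sub_const 1).congr_deriv ?_
    simp only [Function.comp_apply]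
    norm_num
    ring
  have hOE : ∀ x, ΘO x = -(2 * c / A1) * Real.tanh (c * x) * ΘE x := fun x => by
    have e := (hrel x _ (hHd x)).1
    rw [hHt x] at e
    have hp := Real.one_sub_tanh_sq_pos (c * x)
    refine mul_left_cancel₀ (mul_ne_zero (mul_ne_zero two_ne_zero hA1) hp.ne') ?_
    have hσ : A1 * (2 * c / A1) = 2 * c := by field_simp
    linear_combination e + 2 * (1 - Real.tanh (c * x) ^ 2) * Real.tanh (c * x) * ΘE x * hσ
  refine ⟨c, 2 * k / A1, -(2 * c / A1), hc, hHt, fun x => ?_, hOE⟩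
  -- `Θ_E · cosh^δ` has vanishing derivative
  have hconst : ∀ x, HasDerivAt (fun x => ΘE x * Real.cosh (c * x) ^ (2 * k / A1)) 0 x := fun x => by
    refine ((hE x).mul ((hasDerivAt_cosh_rpow _ (c * x)).comp x
      ((hasDerivAt_id x).const_mul c))).congr_deriv ?_
    rw [hOE x]
    simp only [Function.comp_apply]
    field_simp
    ring
  have h1 := is_const_of_deriv_eq_zero (fun x => (hconst x).differentiableAt)
    (fun x => (hconst x).deriv) x 0
  simp only [mul_zero, Real.cosh_zero, Real.one_rpow, mul_one] at h1
  have hcp := Real.cosh_pos (c * x)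
  rw [← h1, mul_assoc, ← Real.rpow_add hcp]
  simp

end Model

/-! ### The classification -/

/-- A power of `cosh` in `L²(ℝ)` has a negative exponent. -/
theorem cosh_rpow_exponent_pos {φ : ℝ → ℝ} {a c δ : ℝ} (ha : a ≠ 0) (hφ : MemLp φ 2 volume)
    (h : ∀ x, φ x = a * Real.cosh (c * x) ^ (-δ)) : 0 < δ := by
  by_contra hδ
  have hi := (memLp_two_iff_integrable_sq hφ.1).mp hφ
  have hconst : Integrable (fun _ : ℝ => a ^ 2) volume := by
    refine hi.mono' aestronglyMeasurable_const (Eventually.of_forall fun x => ?_)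
    have h1 : 1 ≤ Real.cosh (c * x) ^ (-δ) :=
      Real.one_le_rpow (Real.one_le_cosh _) (by linarith)
    rw [Real.norm_of_nonneg (sq_nonneg a), h, mul_pow]
    exact le_mul_of_one_le_right (sq_nonneg a) (one_le_pow₀ h1)
  rw [integrable_const_iff] at hconst
  rcases hconst with h0 | h0
  · exact ha (by simpa using h0)
  · rw [isFiniteMeasure_iff] at h0
    simp at h0

theorem integrable_eval_tanh_sq_mul {α : ℝ} (hα : -1 < α) {c : ℝ} (hc : 0 < c) (q p : ℝ[X]) :
    Integrable (fun x => p.eval (2 * Real.tanh (c * x) ^ 2 - 1)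
      * (q.eval (Real.tanh (c * x)) * Real.cosh (c * x) ^ (-(2 * (α + 1))))) := by
  have h := (integrable_eval_tanh_mul_cosh_rpow hα (p.comp (2 * X ^ 2 - 1) * q)).comp_mul_left'
    hc.ne'
  refine h.congr (Eventually.of_forall fun x => ?_)
  simp only [eval_mul, eval_comp, eval_sub, eval_pow, eval_X, eval_one, eval_ofNat]
  ring

/-- Two orthonormal families of the form `Θ · p_m(2 tanh² - 1)`, `deg p_m = m`, where `Θ²` is a
polynomial in `tanh` times a negative power of `cosh`, agree up to signs. -/
theorem eq_or_eq_neg_of_orthonormal_tanh {α : ℝ} (hα : -1 < α) {c : ℝ} (hc : 0 < c) {q : ℝ[X]}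
    {u v : ℕ → ℝ → ℝ} {Θ : ℝ → ℝ} {p p' : ℕ → ℝ[X]}
    (hΘ : ∀ x, Θ x ^ 2 = q.eval (Real.tanh (c * x)) * Real.cosh (c * x) ^ (-(2 * (α + 1))))
    (hp : ∀ m : ℕ, (p m).degree = m) (hp' : ∀ m : ℕ, (p' m).degree = m)
    (hu : ∀ m x, u m x = Θ x * (p m).eval (2 * Real.tanh (c * x) ^ 2 - 1))
    (hv : ∀ m x, v m x = Θ x * (p' m).eval (2 * Real.tanh (c * x) ^ 2 - 1))
    (hou : ∀ m n, ∫ x, u m x * u n x = if m = n then 1 else 0)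
    (hov : ∀ m n, ∫ x, v m x * v n x = if m = n then 1 else 0) (m : ℕ) :
    ∃ ε : ℝ, (ε = 1 ∨ ε = -1) ∧ ∀ x, v m x = ε * u m x := by
  have key : ∀ f g : ℝ[X], weightedIntegral volume (fun x => 2 * Real.tanh (c * x) ^ 2 - 1) _
      (integrable_eval_tanh_sq_mul hα hc q) (f * g)
      = ∫ x, (Θ x * f.eval (2 * Real.tanh (c * x) ^ 2 - 1))
        * (Θ x * g.eval (2 * Real.tanh (c * x) ^ 2 - 1)) := fun f g => by
    rw [weightedIntegral_apply]
    refine integral_congr_ae (Eventually.of_forall fun x => ?_)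
    simp only [eval_mul]
    rw [← hΘ]
    ring
  rcases eq_or_eq_neg_of_orthonormal (L := weightedIntegral volume _ _
    (integrable_eval_tanh_sq_mul hα hc q)) hp hp'
    (fun i j => by rw [key]; simp only [← hu]; exact hou i j)
    (fun i j => by rw [key]; simp only [← hv]; exact hov i j) m with h | h
  · exact ⟨1, Or.inl rfl, fun x => by rw [hv, hu, h, one_mul]⟩
  · exact ⟨-1, Or.inr rfl, fun x => by rw [hv, hu, h, eval_neg]; ring⟩

/-- The direct half of the classification: the shape of `Θ_E`, `Θ_O` and `H` is forced, and
orthonormality on the line then determines the polynomials up to signs. -/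
theorem exists_eq_dilatedSystem {φ : ℕ → ℝ → ℝ} (hφ : IsHalfRangeSystem φ)
    (ho : IsOrthonormalSystem φ) {D : Matrix ℕ ℕ ℝ} (hD : IsDifferentiationMatrix φ D)
    (ht : IsTridiagonal D) (hs : IsSkewSymmetric D) :
    ∃ α : ℝ, -1 < α ∧ ∃ c : ℝ, 0 < c ∧ ∃ ε : ℕ → ℝ, (∀ m, ε m = 1 ∨ ε m = -1) ∧
      φ = dilatedSystem ε c (halfRangeJacobi α) := by
  obtain ⟨h, H, ΘE, ΘO, wE, wO, r, s, M⟩ := hφ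
  obtain ⟨c, δ, σ, hc, hH, hE, hO⟩ := M.exists_tanh_form hD ht hs
  have hr0 : (r 0).coeff 0 ≠ 0 := coeff_ne_zero_of_eq_degree (M.r_orthonormal.degree_eq 0)
  have hδ : 0 < δ := cosh_rpow_exponent_pos (mul_ne_zero M.ΘE_zero hr0) (ho.1 0) fun x => by
    have := M.even_eq 0 x
    rw [mul_zero] at this
    rw [this, eval_of_degree_eq_zero (M.r_orthonormal.degree_eq 0), hE x]
    ring
  obtain ⟨α, rfl⟩ : ∃ α, δ = α + 1 := ⟨δ - 1, by ring⟩
  have hα : -1 < α := by linarith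
  have hσ : σ ≠ 0 := fun h0 => by
    have h1 := ho.2 1 1
    have h2 : ∀ x, φ 1 x = 0 := fun x => by
      have := M.odd_eq 0 x
      rw [this, hO, h0]; ring
    simp [h2] at h1
  have hoψ : IsOrthonormalSystem (dilatedSystem (fun _ => 1) c (halfRangeJacobi α)) :=
    isOrthonormalSystem_dilatedSystem (isOrthonormalSystem_halfRangeJacobi hα) hc
      fun _ => Or.inl rfl
  have hcosh : ∀ x, (Real.cosh (c * x) ^ (-(α + 1))) ^ 2
      = Real.cosh (c * x) ^ (-(2 * (α + 1))) := fun x => by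
    rw [sq, ← Real.rpow_add (Real.cosh_pos _)]; congr 1; ring
  have heven : ∀ k, ∃ ε : ℝ, (ε = 1 ∨ ε = -1) ∧
      ∀ x, φ (2 * k) x = ε * dilatedSystem (fun _ => 1) c (halfRangeJacobi α) (2 * k) x := by
    refine eq_or_eq_neg_of_orthonormal_tanh hα hc (q := 1)
      (u := fun k => dilatedSystem (fun _ => 1) c (halfRangeJacobi α) (2 * k))
      (v := fun k => φ (2 * k)) (Θ := fun x => Real.cosh (c * x) ^ (-(α + 1)))
      (p := fun k => C (√c * 2 ^ ((2 * α + 1) / 4)) * jacobiOrthonormal α (-1 / 2) k)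
      (p' := fun k => C (ΘE 0) * r k) (fun x => by rw [hcosh]; simp) (fun k => ?_) (fun k => ?_)
      (fun k x => ?_) (fun k x => ?_) (fun m n => ?_) (fun m n => ?_)
    · rw [degree_C_mul (by positivity), degree_jacobiOrthonormal hα (by norm_num)]
    · rw [degree_C_mul M.ΘE_zero, M.r_orthonormal.degree_eq]
    · simp only [dilatedSystem, halfRangeJacobi_two_mul, halfRangeEven_eq, eval_mul, eval_C]
      ring
    · simp only [M.even_eq, hE x, hH x, eval_mul, eval_C]
      ring
    · rw [hoψ.2]; simp
    · rw [ho.2]; simp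
  have hodd : ∀ k, ∃ ε : ℝ, (ε = 1 ∨ ε = -1) ∧ ∀ x, φ (2 * k + 1) x
      = ε * dilatedSystem (fun _ => 1) c (halfRangeJacobi α) (2 * k + 1) x := by
    refine eq_or_eq_neg_of_orthonormal_tanh hα hc (q := X ^ 2)
      (u := fun k => dilatedSystem (fun _ => 1) c (halfRangeJacobi α) (2 * k + 1))
      (v := fun k => φ (2 * k + 1))
      (Θ := fun x => Real.tanh (c * x) * Real.cosh (c * x) ^ (-(α + 1)))
      (p := fun k => C (-(√c * 2 ^ ((2 * α + 3) / 4))) * jacobiOrthonormal α (1 / 2) k)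
      (p' := fun k => C (σ * ΘE 0) * s k) (fun x => by rw [mul_pow, hcosh]; simp)
      (fun k => ?_) (fun k => ?_) (fun k x => ?_) (fun k x => ?_) (fun m n => ?_) (fun m n => ?_)
    · rw [degree_C_mul (neg_ne_zero.mpr (by positivity)),
        degree_jacobiOrthonormal hα (by norm_num)]
    · rw [degree_C_mul (mul_ne_zero hσ M.ΘE_zero), M.s_orthonormal.degree_eq]
    · simp only [dilatedSystem, halfRangeJacobi_two_mul_add_one, halfRangeOdd_eq, eval_mul, eval_C]
      ring
    · simp only [M.odd_eq, hO x, hE x, hH x, eval_mul, eval_C]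
      ring
    · rw [hoψ.2]; simp
    · rw [ho.2]; simp
  have hall : ∀ m, ∃ ε : ℝ, (ε = 1 ∨ ε = -1) ∧
      ∀ x, φ m x = ε * dilatedSystem (fun _ => 1) c (halfRangeJacobi α) m x := fun m => by
    rcases Nat.even_or_odd' m with ⟨k, rfl | rfl⟩
    · exact heven k
    · exact hodd k
  choose ε hε hφε using hall
  refine ⟨α, hα, c, hc, ε, hε, ?_⟩
  funext m x
  rw [hφε, dilatedSystem, dilatedSystem, one_mul]

theorem exists_differentiationMatrix_dilatedSystem {α : ℝ} (hα : -1 < α) (c : ℝ) {ε : ℕ → ℝ}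
    (hε : ∀ m, ε m = 1 ∨ ε m = -1) : ∃ D : Matrix ℕ ℕ ℝ,
      IsDifferentiationMatrix (dilatedSystem ε c (halfRangeJacobi α)) D ∧ IsTridiagonal D ∧
        IsSkewSymmetric D ∧
          ∀ m, D m (m + 1) = c * ε m * ε (m + 1) * halfRangeMatrix hα m (m + 1) := by
  refine ⟨fun m k => c * ε m * ε k * halfRangeMatrix hα m k,
    isDifferentiationMatrix_dilatedSystem (isDifferentiationMatrix_halfRangeMatrix hα) c hε,
    fun m k h => ?_, ?_, fun m => rfl⟩
  · change c * ε m * ε k * halfRangeMatrix hα m k = 0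
    rw [isTridiagonal_halfRangeMatrix hα m k h, mul_zero]
  · ext m k
    change c * ε k * ε m * halfRangeMatrix hα k m = -(c * ε m * ε k * halfRangeMatrix hα m k)
    rw [halfRangeMatrix_swap hα m k]
    ring

theorem theorem2 :
    -- classification of all systems, for an arbitrary skew-symmetric tridiagonal matrix
    (∀ φ : ℕ → ℝ → ℝ,
      (IsHalfRangeSystem φ ∧ IsOrthonormalSystem φ ∧
        ∃ D : Matrix ℕ ℕ ℝ, IsDifferentiationMatrix φ D ∧ IsTridiagonal D ∧ IsSkewSymmetric D) ↔
      ∃ α : ℝ, -1 < α ∧ ∃ c : ℝ, 0 < c ∧ ∃ ε : ℕ → ℝ, (∀ m, ε m = 1 ∨ ε m = -1) ∧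
        ∀ m x, φ m x = ε m * (√c * halfRangeJacobi α m (c * x))) ∧
    -- the same with the sign normalization of a positive superdiagonal
    (∀ φ : ℕ → ℝ → ℝ,
      (IsHalfRangeSystem φ ∧ IsOrthonormalSystem φ ∧
        ∃ D : Matrix ℕ ℕ ℝ, IsDifferentiationMatrix φ D ∧ IsTridiagonal D ∧ IsSkewSymmetric D ∧
          ∀ m, 0 < D m (m + 1)) ↔
      ∃ α : ℝ, -1 < α ∧ ∃ c : ℝ, 0 < c ∧ ∃ ε : ℝ, (ε = 1 ∨ ε = -1) ∧
        ∀ m x, φ m x = ε * (√c * halfRangeJacobi α m (c * x))) ∧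
    -- coincidence with the full-range systems with equal parameters
    (∀ α : ℝ, -1 < α → ∀ (m : ℕ) (x : ℝ), halfRangeJacobi α m x = tanhJacobi α α m x) := by
  refine ⟨fun φ => ⟨?_, ?_⟩, fun φ => ⟨?_, ?_⟩, fun α hα => halfRangeJacobi_eq_tanhJacobi hα⟩
  · rintro ⟨hφ, ho, D, hD, ht, hs⟩
    obtain ⟨α, hα, c, hc, ε, hε, rfl⟩ := exists_eq_dilatedSystem hφ ho hD ht hs
    exact ⟨α, hα, c, hc, ε, hε, fun m x => rfl⟩
  · rintro ⟨α, hα, c, hc, ε, hε, hφ⟩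
    obtain rfl : φ = dilatedSystem ε c (halfRangeJacobi α) := by funext m x; exact hφ m x
    obtain ⟨D, hD, ht, hs, -⟩ := exists_differentiationMatrix_dilatedSystem hα c hε
    exact ⟨isHalfRangeSystem_dilatedSystem hα hc hε,
      isOrthonormalSystem_dilatedSystem (isOrthonormalSystem_halfRangeJacobi hα) hc hε,
      D, hD, ht, hs⟩
  · rintro ⟨hφ, ho, D, hD, ht, hs, hpos⟩
    obtain ⟨α, hα, c, hc, ε, hε, rfl⟩ := exists_eq_dilatedSystem hφ ho hD ht hs
    obtain ⟨D', hD', ht', -, hsup⟩ := exists_differentiationMatrix_dilatedSystem hα c hε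
    have hsucc : ∀ m, ε (m + 1) = ε m := fun m => by
      have h1 := hpos m
      rw [superdiagonal_unique ho hD ht hD' ht', hsup] at h1
      have h2 := mul_pos hc (halfRangeMatrix_superdiagonal_pos hα m)
      have h3 : 0 < ε m * ε (m + 1) := by
        refine (mul_pos_iff_of_pos_right h2).mp ?_
        linarith
      rcases hε m with e | e <;> rcases hε (m + 1) with e' | e' <;> rw [e, e'] at h3 ⊢ <;>
        norm_num at h3
    have hconst : ∀ m, ε m = ε 0 := fun m => by
      induction m with
      | zero => rfl
      | succ m ih => rw [hsucc, ih]
    exact ⟨α, hα, c, hc, ε 0, hε 0, fun m x => by rw [← hconst m]; rfl⟩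
  · rintro ⟨α, hα, c, hc, ε, hε, hφ⟩
    obtain rfl : φ = dilatedSystem (fun _ => ε) c (halfRangeJacobi α) := by
      funext m x; exact hφ m x
    obtain ⟨D, hD, ht, hs, hsup⟩ :=
      exists_differentiationMatrix_dilatedSystem hα c (ε := fun _ => ε) fun _ => hε
    refine ⟨isHalfRangeSystem_dilatedSystem hα hc fun _ => hε,
      isOrthonormalSystem_dilatedSystem (isOrthonormalSystem_halfRangeJacobi hα) hc fun _ => hε,
      D, hD, ht, hs, fun m => ?_⟩
    rw [hsup, mul_assoc c, sq_eq_one_of_sign hε, mul_one]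
    exact mul_pos hc (halfRangeMatrix_superdiagonal_pos hα m)
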